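/- **Conventions.** For $x=x_1\dots x_n\in\{0,1\}^n$ put $x_0=0$, $x_{n+1}=1$, and define the ranks by $r_0=0$ and, for $0\le i\le n$, $r_{i+1}=r_i$ if $x_{i+1}=x_i$ and $r_{i+1}=r_i+1$ otherwise. Let $$f_1(x)=\sum_{i=1}^n i\,x_i,\quad f_2(x)=\sum_{i=1}^n\binom i2 x_i,\quad f_j^r(x)=\sum_{i=1}^{n+1}\binom{r_i}{j}\quad(j=1,2,3),$$ and let the number of runs of $x$ be $r_{n+1}+1$ (the runs of $0x1$). For a real $d>0$, the string $x\in\{0,1\}^n$ is *regular* if each contiguous substring of $x$ of length at least $d\log_2 n$ contains both $00$ and $11$. For integers $D\ge1$, $c\ge 0$, $n\ge2$ put $a=\lceil\log_2 n\rceil$, $b=\lceil\log_2 a\rceil$, $h=\lceil D\log_2 n\rceil$. Divide the positions $1,\dots,n$ into consecutive blocks of length $2h$ (the last may be shorter), and, as a second division, into a first block of length $h$ followed by consecutive blocks of length $2h$ (blocks are cut off at position $n$). For each of the two divisions and $j=2,3$ let $F_j^r(x)$ be the bitwise exclusive-or of the numbers $f_j^r(x^{(i)})$ over the blocks $x^{(i)}$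 of the division, each block being regarded as a binary string by itself. The sketch $s_{D,c}(x)$ is the concatenation of the binary representations of - $f_1(x)$ modulo $2^{a+c}$, $f_2(x)$ modulo $2^{2a+c}$, $f_1^r(x)$ modulo $2^{a+c}$, - for each of the two divisions, $F_2^r(x)$ modulo $2^{2b+c}$ and $F_3^r(x)$ modulo $2^{3b+c}$, - the number of ones of $x$ and the number of runs of $x$, each modulo $2^c$, where a number modulo $2^w$ is written with exactly $w$ bits. **Theorem 5.9.** For every real $d>0$ there are constants $c,C\in\mathbb N$, depending only on $d$, such that the sketch $s=s_{\lceil d\rceil,c}$ has the following properties. 1. $s$ is computable in time polynomial in $n$, by one algorithm for all $n$. 2. For every $n\ge2$ all sketches $s(x)$, $x\in\{0,1\}^n$, have the same length, which is at most $4\log_2 n+10\log_2\log_2 n+C$. 3. For every $n\ge 2$, every regular $x\in\{0,1\}^n$ and every subsequence $y\in\{0,1\}^{n-2}$ obtained from $x$ by deleting two bits, $x$ is uniquely determined by $s(x)$ and $y$: if $z\in\{0,1\}^n$ has $y$ as a subsequence and $s(z)=s(x)$, then $z=x$. -/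

import Mathlib

namespace TwoDeletion

/-! ### Position and run based sketches of binary strings -/

/-- The extended string `0 x₁ … xₙ 1`. -/
def ext (x : List Bool) : List Bool := false :: (x ++ [true])

/-- `bit x i` is the bit `xᵢ` of `x = x₁ … xₙ`, with `x₀ = 0` and `xₙ₊₁ = 1`. -/
def bit (x : List Bool) (i : ℕ) : Bool := (ext x).getD i true

/-- The rank (run number) `rᵢ`: `r₀ = 0`, `rᵢ₊₁ = rᵢ` if `xᵢ₊₁ = xᵢ`, and `rᵢ₊₁ = rᵢ + 1`
otherwise. -/
def rank (x : List Bool) : ℕ → ℕ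
  | 0 => 0
  | i + 1 => if bit x (i + 1) = bit x i then rank x i else rank x i + 1

/-- `f₁(x) = ∑_{i=1}^n i xᵢ`. -/
def f1 (x : List Bool) : ℕ :=
  ∑ i ∈ Finset.Icc 1 x.length, i * (bit x i).toNat

/-- `f₂(x) = ∑_{i=1}^n (i choose 2) xᵢ`. -/
def f2 (x : List Bool) : ℕ :=
  ∑ i ∈ Finset.Icc 1 x.length, i.choose 2 * (bit x i).toNat

/-- `f₁ʳ(x) = ∑_{i=1}^{n+1} rᵢ`. -/
def f1r (x : List Bool) : ℕ :=
  ∑ i ∈ Finset.Icc 1 (x.length + 1), rank x i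

/-- `f₂ʳ(x) = ∑_{i=1}^{n+1} (rᵢ choose 2)`. -/
def f2r (x : List Bool) : ℕ :=
  ∑ i ∈ Finset.Icc 1 (x.length + 1), (rank x i).choose 2

/-- `f₃ʳ(x) = ∑_{i=1}^{n+1} rᵢ (rᵢ - 1) (rᵢ - 2) / 6`. -/
def f3r (x : List Bool) : ℕ :=
  ∑ i ∈ Finset.Icc 1 (x.length + 1), (rank x i).choose 3

/-- The number of ones in `x`. -/
def numOnes (x : List Bool) : ℕ := x.count true

/-- The number of runs in the extended string `0 x 1`. -/
def numRuns (x : List Bool) : ℕ := rank x (x.length + 1) + 1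

/-- `x ∈ {0,1}ⁿ` is regular (with parameter `d`) if each contiguous substring of length at least
`d log₂ n` contains both `00` and `11`. -/
def IsRegular (d : ℝ) (x : List Bool) : Prop :=
  ∀ w : List Bool, w <:+: x → d * Real.logb 2 (x.length : ℝ) ≤ (w.length : ℝ) →
    [false, false] <:+: w ∧ [true, true] <:+: w

/-! ### The two block divisions and the blockwise local sketches -/

/-- The division of `x` into `⌈n / B⌉` consecutive blocks of length `B`
(the last one may be shorter). -/
def blocks (B : ℕ) (x : List Bool) : List (List Bool) :=
  (List.range ((x.length + B - 1) / B)).map fun k => (x.drop (k * B)).take B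

/-- The division into blocks of length `2 h` whose boundaries are shifted by `h` positions:
an initial block of length `h`, then blocks of length `2 h`. -/
def shiftedBlocks (h : ℕ) (x : List Bool) : List (List Bool) :=
  x.take h :: blocks (2 * h) (x.drop h)

/-- The bitwise exclusive-or of the values of `f` on the blocks of a division. -/
def xorSketch (f : List Bool → ℕ) (bs : List (List Bool)) : ℕ :=
  bs.foldr (fun b acc => f b ^^^ acc) 0

/-- The `w` low-order binary digits of `m`, that is, `m` modulo `2 ^ w`. -/
def lowBits (w m : ℕ) : List Bool := (List.range w).map fun i => m.testBit i

/-- The half length `⌈d log₂ n⌉` of the blocks. -/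
def halfBlock (d n : ℕ) : ℕ := Nat.clog 2 (n ^ d)

/-- The sketch: `f₁`, `f₂`, `f₁ʳ`, the two local sketches `F₂ʳ`, `F₃ʳ` for each of the two block
divisions, and the numbers of ones and of runs, each of them modulo a power of two. With
`a = ⌈log₂ n⌉` and `b = ⌈log₂ ⌈log₂ n⌉⌉` the moduli are `2 ^ c` times `2 ^ a`, `2 ^ (2 a)`,
`2 ^ a`, `2 ^ (2 b)`, `2 ^ (3 b)`, `2 ^ (2 b)`, `2 ^ (3 b)`, `1`, `1`. -/
def sketch (d c : ℕ) (x : List Bool) : List Bool :=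
  let a := Nat.clog 2 x.length
  let b := Nat.clog 2 a
  let h := halfBlock d x.length
  lowBits (a + c) (f1 x) ++
  lowBits (2 * a + c) (f2 x) ++
  lowBits (a + c) (f1r x) ++
  lowBits (2 * b + c) (xorSketch f2r (blocks (2 * h) x)) ++
  lowBits (3 * b + c) (xorSketch f3r (blocks (2 * h) x)) ++
  lowBits (2 * b + c) (xorSketch f2r (shiftedBlocks h x)) ++
  lowBits (3 * b + c) (xorSketch f3r (shiftedBlocks h x)) ++
  lowBits c (numOnes x) ++
  lowBits c (numRuns x)

/-! ### Polynomial-time computability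

A structured random access machine: registers and a memory, all holding natural numbers, the
operations being constants, addition, truncated subtraction, indirect reads and writes, tests
for zero and counted loops, each operation costing one step. As there is no multiplication,
numbers have at most `O(t + log n)` bits after `t` steps, so polynomially many steps of this
machine are the same as polynomial time on a Turing machine. -/

/-- Programs. -/
inductive Prog : Type
  /-- do nothing -/
  | skip : Prog
  /-- `R[r] := k` -/
  | const (r k : ℕ) : Prog
  /-- `R[r] := R[p] + R[q]` -/
  | add (r p q : ℕ) : Prog
  /-- `R[r] := R[p] - R[q]`, or `0` if this is negative -/
  | sub (r p q : ℕ) : Prog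
  /-- `R[r] := M[R[p]]` -/
  | load (r p : ℕ) : Prog
  /-- `M[R[p]] := R[q]` -/
  | store (p q : ℕ) : Prog
  /-- first `P`, then `Q` -/
  | seq (P Q : Prog) : Prog
  /-- if `R[r] = 0` then `P` else `Q` -/
  | ifZero (r : ℕ) (P Q : Prog) : Prog
  /-- repeat `P` as many times as the value of `R[r]` on entry -/
  | loop (r : ℕ) (P : Prog) : Prog

/-- The contents of the registers and of the memory. -/
structure Config where
  reg : ℕ → ℕ
  mem : ℕ → ℕ

/-- Assign a value to a register. -/
def Config.setReg (s : Config) (r v : ℕ) : Config := ⟨Function.update s.reg r v, s.mem⟩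

/-- Assign a value to a memory cell. -/
def Config.setMem (s : Config) (i v : ℕ) : Config := ⟨s.reg, Function.update s.mem i v⟩

/-- Run a program: the final configuration, and the number of steps taken. -/
def Prog.exec : Prog → Config → Config × ℕ
  | .skip, s => (s, 1)
  | .const r k, s => (s.setReg r k, 1)
  | .add r p q, s => (s.setReg r (s.reg p + s.reg q), 1)
  | .sub r p q, s => (s.setReg r (s.reg p - s.reg q), 1)
  | .load r p, s => (s.setReg r (s.mem (s.reg p)), 1)
  | .store p q, s => (s.setMem (s.reg p) (s.reg q), 1)
  | .seq P Q, s => ((Q.exec (P.exec s).1).1, (P.exec s).2 + (Q.exec (P.exec s).1).2)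
  | .ifZero r P Q, s =>
      if s.reg r = 0 then ((P.exec s).1, (P.exec s).2 + 1) else ((Q.exec s).1, (Q.exec s).2 + 1)
  | .loop r P, s =>
      (fun e : Config × ℕ => ((P.exec e.1).1, e.2 + (P.exec e.1).2 + 1))^[s.reg r] (s, 1)

/-- The initial configuration: register `0` holds the length of the input, memory cells
`0, 1, …` hold its bits, everything else is zero. -/
def initial (x : List Bool) : Config where
  reg := fun r => if r = 0 then x.length else 0
  mem := fun i => (x.getD i false).toNat

/-- The output: register `0` holds its length, memory cells `0, 1, …` hold its bits. -/
def output (s : Config) : List Bool := (List.range (s.reg 0)).map fun i => s.mem i != 0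

/-- One program, the same for all input lengths, computes `f` in polynomially many steps. -/
def PolyTimeComputable (f : List Bool → List Bool) : Prop :=
  ∃ (P : Prog) (K k : ℕ), ∀ x : List Bool,
    output (P.exec (initial x)).1 = f x ∧ (P.exec (initial x)).2 ≤ K * (x.length + 1) ^ k

end TwoDeletion

/-!
The sketch separates the strings `x` and `z` that share a subsequence `y` with two bits missing for
the following reason. Identify a string with its sequence of bits and compare statistics of
prefixes: `prefixSum w` adds a weight over adjacent pairs of bits, and a deletion (`del`) shifts it
and changes it by a constant (`jump`). All such statistics of `x` and `z` differ by bounded amounts,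
so the residues in the sketch give equality of `f1`, `f2`, `f1r` and of the numbers of ones and of
runs (`abs_global_sub_le`). Summation by parts turns these equalities into vanishing sums: the
prefix counts of ones of `x` and `z` have equal zeroth and first moments, and the prefix counts of
`00` and of `11` have equal zeroth moments, and differences of first moments that are equal for `00`
and `11`.

A function with vanishing zeroth and first moments that changes sign at most once vanishes. If the
two deletions in `x` interleave with those in `z`, the difference of the prefix counts of ones is
such a function, and `x = z` (`eq_of_interleaved`). If both deletions in `x` come before those in
`z`, the signs of the differences of the pair counts show that `x = z`, or that the window between
the outermost deletions contains no pair `bb` for some bit `b`, in which case the difference of the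
ranks has the sign pattern `-`, `+`, `-` (`eq_of_separated`). In the second case regularity makes
the window shorter than half a block, so that it lies in one block of one of the two divisions and
the exclusive-or of the other blocks cancels. On this block three moments of the ranks agree, and a
cubic polynomial whose monotonicity changes where the difference of the ranks changes sign shows
that the ranks are equal (`eq_of_moments`).

For polynomial time, the class `BSum` of functions built by addition, truncated subtraction, reading
of bits and bounded sums is compiled to programs with polynomial running time (`BSum.compile`,
`BList.polyTimeComputable`), and the lengths and bits of all parts of the sketch are written as
bounded sums (`BList.sketch`).
-/

namespace TwoDeletion

/-! ### Pair statistics of bit sequences and the effect of a deletion -/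

/-- The statistic of the prefix `X₀ … Xᵢ` that sums a weight `w` over adjacent pairs of bits. -/
def prefixSum (w : Bool → Bool → ℤ) (X : ℕ → Bool) (i : ℕ) : ℤ :=
  ∑ j ∈ Finset.range i, w (X j) (X (j + 1))

/-- The sequence obtained by deleting the bit at position `p + 1`; the bit at position `0` is never
deleted. -/
def del (p : ℕ) (X : ℕ → Bool) (i : ℕ) : Bool := if i ≤ p then X i else X (i + 1)

/-- The change of a pair statistic when the bit `b` is deleted from the context `a b c`. -/
def jump (w : Bool → Bool → ℤ) (a b c : Bool) : ℤ := w a c - w a b - w b c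

/-- The weight counting ones (in the second place). -/
def wOne (_ b : Bool) : ℤ := if b then 1 else 0

/-- The weight counting pairs `s s`. -/
def wPair (s a b : Bool) : ℤ := if a = s ∧ b = s then 1 else 0

/-- The weight counting the boundaries between runs. -/
def wRun (a b : Bool) : ℤ := if b = a then 0 else 1

@[simp] theorem prefixSum_zero (w : Bool → Bool → ℤ) (X : ℕ → Bool) : prefixSum w X 0 = 0 := by
  simp [prefixSum]

theorem prefixSum_succ (w : Bool → Bool → ℤ) (X : ℕ → Bool) (i : ℕ) :
    prefixSum w X (i + 1) = prefixSum w X i + w (X i) (X (i + 1)) := by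
  simp [prefixSum, Finset.sum_range_succ]

theorem prefixSum_congr {w : Bool → Bool → ℤ} {X Z : ℕ → Bool} {i : ℕ}
    (h : ∀ j ≤ i, X j = Z j) : prefixSum w X i = prefixSum w Z i := by
  refine Finset.sum_congr rfl fun j hj => ?_
  have := Finset.mem_range.1 hj
  rw [h j (by omega), h (j + 1) (by omega)]

theorem del_of_le {p i : ℕ} (X : ℕ → Bool) (h : i ≤ p) : del p X i = X i := if_pos h

theorem del_of_lt {p i : ℕ} (X : ℕ → Bool) (h : p < i) : del p X i = X (i + 1) :=
  if_neg (by omega)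

theorem prefixSum_del_of_le (w : Bool → Bool → ℤ) (X : ℕ → Bool) {p i : ℕ} (h : i ≤ p) :
    prefixSum w (del p X) i = prefixSum w X i :=
  prefixSum_congr fun _ hj => del_of_le X (by omega)

theorem prefixSum_del_of_lt (w : Bool → Bool → ℤ) (X : ℕ → Bool) {p i : ℕ} (h : p < i) :
    prefixSum w (del p X) i =
      prefixSum w X (i + 1) + jump w (X p) (X (p + 1)) (X (p + 2)) := by
  induction i, h using Nat.le_induction with
  | base =>
    rw [prefixSum_succ, prefixSum_del_of_le w X le_rfl, prefixSum_succ, prefixSum_succ,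
      del_of_le X le_rfl, del_of_lt X (Nat.lt_succ_self p), jump]
    ring
  | succ i hi ih =>
    rw [prefixSum_succ, ih, prefixSum_succ w X (i + 1), del_of_lt X (by omega),
      del_of_lt X (by omega)]
    ring

/-- Deleting at two positions in either order. -/
theorem del_del_comm (X : ℕ → Bool) {p q : ℕ} (h : p ≤ q) :
    del p (del (q + 1) X) = del q (del p X) := by
  funext i
  simp only [del]
  split_ifs <;> first | rfl | omega

/-- A single deletion moves a `0/1`-valued pair statistic of a prefix by at most `2`. -/
theorem abs_prefixSum_del_sub_le {w : Bool → Bool → ℤ} (h0 : ∀ a b, 0 ≤ w a b)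
    (h1 : ∀ a b, w a b ≤ 1) (X : ℕ → Bool) (p i : ℕ) :
    |prefixSum w (del p X) i - prefixSum w X i| ≤ 2 := by
  rcases le_or_gt i p with h | h
  · simp [prefixSum_del_of_le w X h]
  · rw [prefixSum_del_of_lt w X h, prefixSum_succ, jump, abs_le]
    have := h0 (X p) (X (p + 1))
    have := h0 (X p) (X (p + 2))
    have := h0 (X (p + 1)) (X (p + 2))
    have := h0 (X i) (X (i + 1))
    have := h1 (X p) (X (p + 1))
    have := h1 (X p) (X (p + 2))
    have := h1 (X (p + 1)) (X (p + 2))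
    have := h1 (X i) (X (i + 1))
    constructor <;> linarith

theorem wOne_nonneg (a b : Bool) : 0 ≤ wOne a b := by revert a b; decide
theorem wOne_le_one (a b : Bool) : wOne a b ≤ 1 := by revert a b; decide
theorem wRun_nonneg (a b : Bool) : 0 ≤ wRun a b := by revert a b; decide
theorem wRun_le_one (a b : Bool) : wRun a b ≤ 1 := by revert a b; decide
theorem wPair_nonneg (s a b : Bool) : 0 ≤ wPair s a b := by revert s a b; decide
theorem wPair_le_one (s a b : Bool) : wPair s a b ≤ 1 := by revert s a b; decide

/-- Every adjacent pair is `00`, `11` or a run boundary. -/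
theorem prefixSum_wRun (X : ℕ → Bool) (i : ℕ) :
    prefixSum wRun X i = i - prefixSum (wPair false) X i - prefixSum (wPair true) X i := by
  induction i with
  | zero => simp
  | succ i ih =>
    have : ∀ a b, wRun a b = 1 - wPair false a b - wPair true a b := by decide
    rw [prefixSum_succ, prefixSum_succ, prefixSum_succ, ih, this]
    push_cast; ring

/-- The number of ones in terms of the numbers of pairs `00` and `11`. -/
theorem two_mul_prefixSum_wOne (X : ℕ → Bool) (i : ℕ) :
    2 * prefixSum wOne X i = prefixSum (wPair true) X i - prefixSum (wPair false) X i + i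
      + wOne false (X i) - wOne false (X 0) := by
  induction i with
  | zero => simp
  | succ i ih =>
    have : ∀ a b, 2 * wOne a b =
      wPair true a b - wPair false a b + 1 + wOne false b - wOne false a := by decide
    rw [prefixSum_succ, prefixSum_succ, prefixSum_succ, mul_add, ih, this]
    push_cast; ring

/-! ### Moments and sign changes -/

theorem eq_zero_of_nonneg_of_sum {N : ℕ} {F : ℕ → ℤ} (h : ∀ i < N, 0 ≤ F i)
    (h0 : ∑ i ∈ Finset.range N, F i = 0) : ∀ i < N, F i = 0 := fun i hi =>
  (Finset.sum_eq_zero_iff_of_nonneg fun i hi => h i (Finset.mem_range.1 hi)).1 h0 i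
    (Finset.mem_range.2 hi)

theorem eq_zero_of_nonpos_of_sum {N : ℕ} {F : ℕ → ℤ} (h : ∀ i < N, F i ≤ 0)
    (h0 : ∑ i ∈ Finset.range N, F i = 0) : ∀ i < N, F i = 0 := fun i hi =>
  (Finset.sum_eq_zero_iff_of_nonpos fun i hi => h i (Finset.mem_range.1 hi)).1 h0 i
    (Finset.mem_range.2 hi)

/-- When the zeroth moment vanishes, a linear weight may be shifted freely. The values of
`2 (i - m) + 1` are odd, hence never zero, and change sign between `m - 1` and `m`. -/
theorem sum_mul_linear {N : ℕ} {F : ℕ → ℤ} (m : ℕ) (h0 : ∑ i ∈ Finset.range N, F i = 0) :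
    ∑ i ∈ Finset.range N, (2 * ((i : ℤ) - m) + 1) * F i =
      2 * ∑ i ∈ Finset.range N, (i : ℤ) * F i := by
  have : ∑ i ∈ Finset.range N, (2 * ((i : ℤ) - m) + 1) * F i =
      2 * ∑ i ∈ Finset.range N, (i : ℤ) * F i +
        (1 - 2 * (m : ℤ)) * ∑ i ∈ Finset.range N, F i := by
    rw [Finset.mul_sum, Finset.mul_sum, ← Finset.sum_add_distrib]
    exact Finset.sum_congr rfl fun i _ => by ring
  rw [this, h0]; ring

/-- Multiplying by a linear function that changes sign with `F` makes all terms nonnegative. -/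
theorem mul_linear_nonneg {N m : ℕ} {F : ℕ → ℤ} (h1 : ∀ i < N, i < m → F i ≤ 0)
    (h2 : ∀ i < N, m ≤ i → 0 ≤ F i) : ∀ i < N, 0 ≤ (2 * ((i : ℤ) - m) + 1) * F i := by
  intro i hi
  rcases lt_or_ge i m with h | h
  · exact mul_nonneg_of_nonpos_of_nonpos (by omega) (h1 i hi h)
  · exact mul_nonneg (by omega) (h2 i hi h)

/-- A function with vanishing sum that changes sign once, from `-` to `+`, has a nonnegative first
moment. -/
theorem first_moment_nonneg {N m : ℕ} {F : ℕ → ℤ} (h0 : ∑ i ∈ Finset.range N, F i = 0)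
    (h1 : ∀ i < N, i < m → F i ≤ 0) (h2 : ∀ i < N, m ≤ i → 0 ≤ F i) :
    0 ≤ ∑ i ∈ Finset.range N, (i : ℤ) * F i := by
  have := Finset.sum_nonneg fun i hi => mul_linear_nonneg h1 h2 i (Finset.mem_range.1 hi)
  rw [sum_mul_linear m h0] at this
  linarith

/-- If moreover the first moment vanishes, the function does. -/
theorem eq_zero_of_moments {N m : ℕ} {F : ℕ → ℤ} (h0 : ∑ i ∈ Finset.range N, F i = 0)
    (h1 : ∀ i < N, i < m → F i ≤ 0) (h2 : ∀ i < N, m ≤ i → 0 ≤ F i)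
    (h3 : ∑ i ∈ Finset.range N, (i : ℤ) * F i = 0) : ∀ i < N, F i = 0 := by
  intro i hi
  have := eq_zero_of_nonneg_of_sum (mul_linear_nonneg h1 h2) (by rw [sum_mul_linear m h0, h3]; rfl)
    i hi
  rcases mul_eq_zero.1 this with h | h
  · omega
  · exact h

/-- A function with vanishing zeroth and first moments and at most one sign change vanishes. -/
theorem eq_zero_of_one_sign_change {N m : ℕ} {F : ℕ → ℤ}
    (h0 : ∑ i ∈ Finset.range N, F i = 0) (h3 : ∑ i ∈ Finset.range N, (i : ℤ) * F i = 0)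
    (h1 : (∀ i < N, i < m → F i ≤ 0) ∨ ∀ i < N, i < m → 0 ≤ F i)
    (h2 : (∀ i < N, m ≤ i → F i ≤ 0) ∨ ∀ i < N, m ≤ i → 0 ≤ F i) : ∀ i < N, F i = 0 := by
  rcases h1 with h1 | h1 <;> rcases h2 with h2 | h2
  · exact eq_zero_of_nonpos_of_sum
      (fun i hi => (lt_or_ge i m).elim (h1 i hi) (h2 i hi)) h0
  · exact eq_zero_of_moments h0 h1 h2 h3
  · have := eq_zero_of_moments (N := N) (m := m) (F := fun i => - F i) (by simp [h0])
      (fun i hi h => by simpa using h1 i hi h) (fun i hi h => by simpa using h2 i hi h)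
      (by simp [h3])
    exact fun i hi => by simpa using this i hi
  · exact eq_zero_of_nonneg_of_sum
      (fun i hi => (lt_or_ge i m).elim (h1 i hi) (h2 i hi)) h0

/-! ### Two strings with a common subsequence: interleaved deletions -/

theorem prefixSum_wOne_del (X : ℕ → Bool) {p j : ℕ} (h : p ≤ j) :
    prefixSum wOne X (j + 1) = prefixSum wOne (del p X) j + wOne false (X (p + 1)) := by
  rcases h.eq_or_lt with rfl | h
  · rw [prefixSum_del_of_le _ _ le_rfl, prefixSum_succ]; rfl
  · rw [prefixSum_del_of_lt _ _ h, jump]; simp [wOne]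

/-- Two sequences that agree at `0` agree at `i` as soon as the differences of the prefix counts of
`11` and of `00` have the same parity there. -/
theorem eq_of_pair_parity {X Z : ℕ → Bool} (h0 : X 0 = Z 0) {i : ℕ} {t : ℤ}
    (h : prefixSum (wPair true) X i - prefixSum (wPair true) Z i
      - (prefixSum (wPair false) X i - prefixSum (wPair false) Z i) = 2 * t) : X i = Z i := by
  have hx := two_mul_prefixSum_wOne X i
  have hz := two_mul_prefixSum_wOne Z i
  rw [h0] at hx
  have key : wOne false (X i) - wOne false (Z i) =
      2 * (prefixSum wOne X i - prefixSum wOne Z i - t) := by linarith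
  generalize prefixSum wOne X i - prefixSum wOne Z i - t = u at key
  cases hX : X i <;> cases hZ : Z i <;> simp only [hX, hZ, wOne] at key ⊢ <;> simp at key <;> omega

theorem eq_of_prefixSum_wOne {X Z : ℕ → Bool} (h0 : X 0 = Z 0) {N : ℕ}
    (h : ∀ i < N, prefixSum wOne X i - prefixSum wOne Z i = 0) : ∀ i < N, X i = Z i := by
  intro i hi
  rcases i with _ | i
  · exact h0
  · have h1 := h i (by omega)
    have h2 := h (i + 1) hi
    rw [prefixSum_succ, prefixSum_succ] at h2
    cases hX : X (i + 1) <;> cases hZ : Z (i + 1) <;> simp only [hX, hZ, wOne] at h2 ⊢ <;>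
      simp at h2 <;> omega

/-- If, from left to right, the first deletion in `Z` comes before the second deletion in `X`, then
the difference of the prefix counts of ones changes sign at most once, and so `X = Z` as soon
as its zeroth and first moments vanish. -/
theorem eq_of_interleaved {X Z : ℕ → Bool} {p P q Q N M : ℕ} (h0 : X 0 = Z 0) (hpq : p ≤ q)
    (hqP : q ≤ P) (hqQ : q ≤ Q) (hY : del P (del p X) = del Q (del q Z))
    (hP : P + 2 ≤ M) (hQ : Q + 2 ≤ M) (hM : prefixSum wOne X M = prefixSum wOne Z M)
    (hD : ∑ i ∈ Finset.range N, (prefixSum wOne X i - prefixSum wOne Z i) = 0)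
    (hD1 : ∑ i ∈ Finset.range N, (i : ℤ) * (prefixSum wOne X i - prefixSum wOne Z i) = 0) :
    ∀ i < N, X i = Z i := by
  set X' := del p X with hX'
  set Z' := del q Z with hZ'
  set Y := del P X' with hYdef
  -- the deleted bits
  obtain ⟨a₁, ha₁⟩ : ∃ a, a = X (p + 1) := ⟨_, rfl⟩
  obtain ⟨a₂, ha₂⟩ : ∃ a, a = X' (P + 1) := ⟨_, rfl⟩
  obtain ⟨b₁, hb₁⟩ : ∃ a, a = Z (q + 1) := ⟨_, rfl⟩
  obtain ⟨b₂, hb₂⟩ : ∃ a, a = Z' (Q + 1) := ⟨_, rfl⟩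
  have hX1 : ∀ j, p ≤ j → prefixSum wOne X (j + 1) = prefixSum wOne X' j + wOne false a₁ :=
    fun j hj => ha₁ ▸ prefixSum_wOne_del X hj
  have hX2 : ∀ j, P ≤ j → prefixSum wOne X' (j + 1) = prefixSum wOne Y j + wOne false a₂ :=
    fun j hj => ha₂ ▸ prefixSum_wOne_del X' hj
  have hZ1 : ∀ j, q ≤ j → prefixSum wOne Z (j + 1) = prefixSum wOne Z' j + wOne false b₁ :=
    fun j hj => hb₁ ▸ prefixSum_wOne_del Z hj
  have hZ2 : ∀ j, Q ≤ j → prefixSum wOne Z' (j + 1) = prefixSum wOne Y j + wOne false b₂ :=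
    fun j hj => hb₂ ▸ hY ▸ prefixSum_wOne_del Z' hj
  have hX3 : ∀ j, j ≤ P → prefixSum wOne X' j = prefixSum wOne Y j :=
    fun j hj => (prefixSum_del_of_le wOne X' hj).symm
  have hZ3 : ∀ j, j ≤ Q → prefixSum wOne Z' j = prefixSum wOne Y j :=
    fun j hj => hY ▸ (prefixSum_del_of_le wOne Z' hj).symm
  have hsum : wOne false a₁ + wOne false a₂ = wOne false b₁ + wOne false b₂ := by
    obtain ⟨k, rfl⟩ : ∃ k, M = k + 1 + 1 := ⟨M - 2, by omega⟩
    rw [hX1 _ (by omega), hX2 _ (by omega), hZ1 _ (by omega), hZ2 _ (by omega)] at hM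
    linarith
  have hbit : ∀ b, 0 ≤ wOne false b ∧ wOne false b ≤ 1 := by decide
  refine eq_of_prefixSum_wOne h0 (eq_zero_of_one_sign_change (m := q + 1) hD hD1 ?_ ?_)
  · have key : ∀ i < q + 1, prefixSum wOne X i - prefixSum wOne Z i = 0 ∨
        ∃ e, prefixSum wOne X i - prefixSum wOne Z i = wOne false a₁ - wOne false e := by
      intro i hi
      have hz : prefixSum wOne Z i = prefixSum wOne X' i := by
        rw [hX3 i (by omega), ← hZ3 i (by omega), hZ', prefixSum_del_of_le _ _ (by omega)]
      rcases le_or_gt i p with h | h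
      · left; rw [hz, hX', prefixSum_del_of_le _ _ h, sub_self]
      · right
        obtain ⟨j, rfl⟩ : ∃ j, i = j + 1 := ⟨i - 1, by omega⟩
        refine ⟨X' (j + 1), ?_⟩
        rw [hz, hX1 j (by omega), prefixSum_succ wOne X']
        simp only [wOne]; ring
    cases a₁
    · left; intro i _ hi
      rcases key i hi with h | ⟨e, h⟩ <;> rw [h]
      have := (hbit e).1; simp only [wOne] at this ⊢; simp at this ⊢; exact this
    · right; intro i _ hi
      rcases key i hi with h | ⟨e, h⟩ <;> rw [h]
      have := (hbit e).2; simp only [wOne] at this ⊢; simp at this ⊢; exact this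
  · have key : ∀ i, q + 1 ≤ i → ∃ e,
        prefixSum wOne X i - prefixSum wOne Z i = wOne false b₂ - wOne false a₂ ∨
        prefixSum wOne X i - prefixSum wOne Z i = 0 ∨
        (P < Q ∧ prefixSum wOne X i - prefixSum wOne Z i = wOne false b₂ - wOne false e) ∨
        (Q < P ∧ prefixSum wOne X i - prefixSum wOne Z i = wOne false e - wOne false a₂) := by
      intro i hi
      obtain ⟨j, rfl⟩ : ∃ j, i = j + 1 := ⟨i - 1, by omega⟩
      refine ⟨Y j, ?_⟩
      rw [hX1 j (by omega), hZ1 j (by omega)]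
      have step : ∀ k, prefixSum wOne Y (k + 1) = prefixSum wOne Y k + wOne false (Y (k + 1)) :=
        fun k => prefixSum_succ wOne Y k
      rcases le_or_gt j P with h | h <;> rcases le_or_gt j Q with h' | h'
      · rw [hX3 j h, hZ3 j h']; left; linarith
      · obtain ⟨k, rfl⟩ : ∃ k, j = k + 1 := ⟨j - 1, by omega⟩
        rw [hX3 _ h, hZ2 k (by omega), step]
        right; right; right; exact ⟨by omega, by linarith⟩
      · obtain ⟨k, rfl⟩ : ∃ k, j = k + 1 := ⟨j - 1, by omega⟩
        rw [hZ3 _ h', hX2 k (by omega), step]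
        right; right; left; exact ⟨by omega, by linarith⟩
      · obtain ⟨k, rfl⟩ : ∃ k, j = k + 1 := ⟨j - 1, by omega⟩
        rw [hZ2 k (by omega), hX2 k (by omega)]
        right; left; linarith
    have ha := hbit a₂
    have hb := hbit b₂
    have zo : ∀ b, wOne false b = 0 ∨ wOne false b = 1 := by decide
    rcases le_or_gt P Q with h | h
    · rcases zo b₂ with h1 | h1
      · left; intro i _ hi
        obtain ⟨e, he⟩ := key i hi
        have := hbit e
        omega
      · right; intro i _ hi
        obtain ⟨e, he⟩ := key i hi
        have := hbit e
        omega
    · rcases zo a₂ with h1 | h1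
      · right; intro i _ hi
        obtain ⟨e, he⟩ := key i hi
        have := hbit e
        omega
      · left; intro i _ hi
        obtain ⟨e, he⟩ := key i hi
        have := hbit e
        omega

/-! ### Two strings with a common subsequence: separated deletions -/

/-- The difference of a pair statistic of the prefixes of `X` and `Z` when both deletions in `X`
come before both deletions in `Z`. -/
theorem prefixSum_sub_of_separated (w : Bool → Bool → ℤ) {X Z : ℕ → Bool} {p P q Q M : ℕ}
    (hpP : p ≤ P) (hPq : P < q) (hqQ : q ≤ Q)
    (hY : del P (del p X) = del q (del (Q + 1) Z)) (hQ : Q + 3 ≤ M)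
    (hM : prefixSum w X M = prefixSum w Z M) {k₁ k₂ l₁ l₂ : ℤ}
    (hk₁ : k₁ = jump w (X p) (X (p + 1)) (X (p + 2)))
    (hk₂ : k₂ = jump w (del p X P) (del p X (P + 1)) (del p X (P + 2)))
    (hl₁ : l₁ = jump w (del (Q + 1) Z q) (del (Q + 1) Z (q + 1)) (del (Q + 1) Z (q + 2)))
    (hl₂ : l₂ = jump w (Z (Q + 1)) (Z (Q + 2)) (Z (Q + 3))) :
    k₁ + k₂ = l₁ + l₂ ∧
    (∀ i ≤ p, prefixSum w X i - prefixSum w Z i = 0) ∧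
    (∀ i, p < i → i ≤ P → prefixSum w X i - prefixSum w Z i = -k₁ - w (X i) (X (i + 1))) ∧
    (∀ i, P < i → i ≤ q → prefixSum w X i - prefixSum w Z i =
      -(k₁ + k₂) - w (X i) (X (i + 1)) - w (X (i + 1)) (X (i + 2))) ∧
    (prefixSum w X (q + 1) - prefixSum w Z (q + 1) =
      -(k₁ + k₂) - w (X (q + 1)) (X (q + 2)) - w (Z q) (Z (q + 1))) ∧
    (∀ i, q + 2 ≤ i → i ≤ Q + 1 →
      prefixSum w X i - prefixSum w Z i = -l₂ - w (X i) (X (i + 1))) ∧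
    (prefixSum w X (Q + 2) - prefixSum w Z (Q + 2) =
      w (Z (Q + 2)) (Z (Q + 3)) - w (X (Q + 2)) (X (Q + 3))) ∧
    (∀ i, Q + 3 ≤ i → prefixSum w X i - prefixSum w Z i = 0) := by
  have hX1 : ∀ i, p < i → prefixSum w (del p X) i = prefixSum w X (i + 1) + k₁ :=
    fun i hi => hk₁ ▸ prefixSum_del_of_lt w X hi
  have hX2 : ∀ i, P < i → prefixSum w (del P (del p X)) i = prefixSum w (del p X) (i + 1) + k₂ :=
    fun i hi => hk₂ ▸ prefixSum_del_of_lt w (del p X) hi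
  have hX3 : ∀ i, i ≤ P → prefixSum w (del P (del p X)) i = prefixSum w (del p X) i :=
    fun i hi => prefixSum_del_of_le w (del p X) hi
  have hX4 : ∀ i, i ≤ p → prefixSum w (del p X) i = prefixSum w X i :=
    fun i hi => prefixSum_del_of_le w X hi
  have hZ1 : ∀ i, Q + 1 < i → prefixSum w (del (Q + 1) Z) i = prefixSum w Z (i + 1) + l₂ :=
    fun i hi => hl₂ ▸ prefixSum_del_of_lt w Z hi
  have hZ2 : ∀ i, q < i →
      prefixSum w (del P (del p X)) i = prefixSum w (del (Q + 1) Z) (i + 1) + l₁ :=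
    fun i hi => hl₁ ▸ hY ▸ prefixSum_del_of_lt w (del (Q + 1) Z) hi
  have hZ3 : ∀ i, i ≤ q → prefixSum w (del P (del p X)) i = prefixSum w (del (Q + 1) Z) i :=
    fun i hi => hY ▸ prefixSum_del_of_le w (del (Q + 1) Z) hi
  have hZ4 : ∀ i, i ≤ Q + 1 → prefixSum w (del (Q + 1) Z) i = prefixSum w Z i :=
    fun i hi => prefixSum_del_of_le w Z hi
  have hXP : ∀ i, P < i → prefixSum w (del P (del p X)) i = prefixSum w X (i + 2) + k₁ + k₂ :=
    fun i hi => by rw [hX2 i hi, hX1 (i + 1) (by omega)]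
  have hZP : ∀ i, Q < i → prefixSum w (del P (del p X)) i = prefixSum w Z (i + 2) + l₁ + l₂ :=
    fun i hi => by rw [hZ2 i (by omega), hZ1 (i + 1) (by omega)]; ring
  have hk : k₁ + k₂ = l₁ + l₂ := by
    obtain ⟨m, rfl⟩ : ∃ m, M = m + 2 := ⟨M - 2, by omega⟩
    have h1 := hXP m (by omega)
    have h2 := hZP m (by omega)
    linarith
  have hend : ∀ i, Q + 3 ≤ i → prefixSum w X i - prefixSum w Z i = 0 := by
    intro i hi
    obtain ⟨m, rfl⟩ : ∃ m, i = m + 2 := ⟨i - 2, by omega⟩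
    have h1 := hXP m (by omega)
    have h2 := hZP m (by omega)
    linarith
  refine ⟨hk, ?_, ?_, ?_, ?_, ?_, ?_, hend⟩
  · intro i hi
    rw [← hX4 i hi, ← hX3 i (by omega), hZ3 i (by omega), hZ4 i (by omega), sub_self]
  · intro i hi hi'
    have h1 := hX1 i hi
    rw [← hX3 i hi', hZ3 i (by omega), hZ4 i (by omega), prefixSum_succ] at h1
    linarith
  · intro i hi hi'
    have h1 := hXP i hi
    rw [hZ3 i hi', hZ4 i (by omega), prefixSum_succ, prefixSum_succ] at h1
    linarith
  · have h1 := hXP q hPq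
    rw [hZ3 q le_rfl, hZ4 q (by omega), prefixSum_succ w X (q + 1)] at h1
    rw [prefixSum_succ w Z]
    linarith
  · intro i hi hi'
    obtain ⟨j, rfl⟩ : ∃ j, i = j + 1 := ⟨i - 1, by omega⟩
    have h1 := hXP j (by omega)
    rw [hZ2 j (by omega), hZ4 (j + 1) hi', prefixSum_succ w X (j + 1)] at h1
    linarith
  · have h1 := hend (Q + 3) le_rfl
    rw [prefixSum_succ w X (Q + 2), prefixSum_succ w Z (Q + 2)] at h1
    linarith

/-- Deleting a bit `β` either shortens a run of `β`, which loses a pair `β β`, or removes a run of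
length one, which creates a pair of the complementary bit. -/
theorem jump_wPair (a b c : Bool) :
    (jump (wPair b) a b c = -1 ∧ jump (wPair !b) a b c = 0 ∧ (a = b ∨ c = b)) ∨
    (jump (wPair b) a b c = 0 ∧ jump (wPair !b) a b c = 1 ∧ a = (!b) ∧ c = !b) := by
  revert a b c; decide

/-- The sign pattern `-`, `+`, `-` (in the weak sense) of a function on `ℕ`, with the changes at `i₁`
and `i₂`; each part may be empty. -/
def NegPosNeg (F : ℕ → ℤ) : Prop :=
  ∃ i₁ i₂ : ℕ, (∀ i < i₁, F i ≤ 0) ∧ (∀ i, i₁ ≤ i → i < i₂ → 0 ≤ F i) ∧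
    ∀ i, i₁ ≤ i → i₂ ≤ i → F i ≤ 0

theorem wPair_add (b x y : Bool) : 0 ≤ wPair b x y + wPair (!b) x y ∧
    wPair b x y + wPair (!b) x y ≤ 1 := by
  revert b x y; decide

theorem prefixSum_wRun_sub (X Z : ℕ → Bool) (b : Bool) (i : ℕ) :
    prefixSum wRun X i - prefixSum wRun Z i =
      -((prefixSum (wPair b) X i - prefixSum (wPair b) Z i) +
        (prefixSum (wPair !b) X i - prefixSum (wPair !b) Z i)) := by
  rw [prefixSum_wRun, prefixSum_wRun]
  cases b <;> simp <;> ring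

/-- If both deletions in `X` come before both deletions in `Z` and the two bits deleted in `X` are
equal, then the numbers of ones in prefixes change in one direction only. -/
theorem eq_of_separated_of_eq_bits {X Z : ℕ → Bool} {p P q Q N M : ℕ} (h0 : X 0 = Z 0)
    (hpP : p ≤ P) (hPq : P < q) (hqQ : q ≤ Q)
    (hY : del P (del p X) = del q (del (Q + 1) Z)) (hQ : Q + 3 ≤ M)
    (hM1 : prefixSum wOne X M = prefixSum wOne Z M)
    (hD : ∑ i ∈ Finset.range N, (prefixSum wOne X i - prefixSum wOne Z i) = 0)
    {a₁ a₂ b₁ b₂ : Bool} (hb₂ : b₂ = Z (Q + 2))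
    (ha₁ : a₁ = X (p + 1)) (ha₂ : a₂ = del p X (P + 1)) (hXZ : X (Q + 3) = Z (Q + 3))
    (hsum : wOne false a₁ + wOne false a₂ = wOne false b₁ + wOne false b₂) (haa : a₁ = a₂) :
    ∀ i < N, X i = Z i := by
  have hone := prefixSum_sub_of_separated wOne hpP hPq hqQ hY hQ hM1 rfl rfl rfl rfl
  obtain ⟨-, r0, r1, r2, r3, r4, r5, r6⟩ := hone
  have hbb : b₁ = a₁ ∧ b₂ = a₁ := by
    subst haa; revert hsum; clear * -; revert a₁ b₁ b₂; decide
  have j1 : jump wOne (X p) (X (p + 1)) (X (p + 2)) = - wOne false a₁ := by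
    rw [← ha₁]; simp [jump, wOne]
  have j2 : jump wOne (del p X P) (del p X (P + 1)) (del p X (P + 2)) = - wOne false a₁ := by
    rw [← ha₂, ← haa]; simp [jump, wOne]
  have j3 : jump wOne (Z (Q + 1)) (Z (Q + 2)) (Z (Q + 3)) = - wOne false a₁ := by
    rw [← hb₂, hbb.2]; simp [jump, wOne]
  simp only [j1, j2, j3] at r1 r2 r3 r4 r5
  rw [hXZ] at r5
  have r5' : prefixSum wOne X (Q + 2) - prefixSum wOne Z (Q + 2) = 0 := by
    rw [r5]; simp [wOne]
  have hw0 := wOne_nonneg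
  have hw1 := wOne_le_one
  refine eq_of_prefixSum_wOne h0 ?_
  have cases_i : ∀ i, i ≤ p ∨ (p < i ∧ i ≤ P) ∨ (P < i ∧ i ≤ q) ∨ i = q + 1 ∨
    (q + 2 ≤ i ∧ i ≤ Q + 1) ∨ i = Q + 2 ∨ Q + 3 ≤ i := by intro i; omega
  cases a₁
  · refine eq_zero_of_nonpos_of_sum (fun i _ => ?_) hD
    have z : wOne false false = 0 := rfl
    simp only [z] at r1 r2 r3 r4
    rcases cases_i i with h | h | h | h | h | h | h
    · rw [r0 i h]
    · rw [r1 i h.1 h.2]; linarith [hw0 (X i) (X (i + 1))]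
    · rw [r2 i h.1 h.2]; linarith [hw0 (X i) (X (i + 1)), hw0 (X (i + 1)) (X (i + 2))]
    · rw [h, r3]; linarith [hw0 (X (q + 1)) (X (q + 2)), hw0 (Z q) (Z (q + 1))]
    · rw [r4 i h.1 h.2]; linarith [hw0 (X i) (X (i + 1))]
    · rw [h, r5']
    · rw [r6 i h]
  · refine eq_zero_of_nonneg_of_sum (fun i _ => ?_) hD
    have z : wOne false true = 1 := rfl
    simp only [z] at r1 r2 r3 r4
    rcases cases_i i with h | h | h | h | h | h | h
    · rw [r0 i h]
    · rw [r1 i h.1 h.2]; linarith [hw1 (X i) (X (i + 1))]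
    · rw [r2 i h.1 h.2]; linarith [hw1 (X i) (X (i + 1)), hw1 (X (i + 1)) (X (i + 2))]
    · rw [h, r3]; linarith [hw1 (X (q + 1)) (X (q + 2)), hw1 (Z q) (Z (q + 1))]
    · rw [r4 i h.1 h.2]; linarith [hw1 (X i) (X (i + 1))]
    · rw [h, r5']
    · rw [r6 i h]

set_option maxHeartbeats 1000000 in
/-- If both deletions in `X` come before both deletions in `Z`, and the moments of the pair counts
are those enforced by the sketch, then `X` and `Z` are equal, or one kind `bb` of pairs is absent
from the window between the outermost deletions and the difference of the ranks has sign pattern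
`-`, `+`, `-`. Here `Q + 2` is the position in `Z` of the last deleted bit. The cases depend on
which of the deletions shorten a run and which remove a run of length one. -/
theorem eq_of_separated {X Z : ℕ → Bool} {p P q Q N M : ℕ} (h0 : X 0 = Z 0)
    (hpP : p ≤ P) (hPq : P < q) (hqQ : q ≤ Q)
    (hY : del P (del p X) = del q (del (Q + 1) Z)) (hQ : Q + 3 ≤ M) (hN : Q + 3 ≤ N)
    (hM : ∀ b, prefixSum (wPair b) X M = prefixSum (wPair b) Z M)
    (hM1 : prefixSum wOne X M = prefixSum wOne Z M)
    (hD : ∑ i ∈ Finset.range N, (prefixSum wOne X i - prefixSum wOne Z i) = 0)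
    (hC : ∀ b, ∑ i ∈ Finset.range N, (prefixSum (wPair b) X i - prefixSum (wPair b) Z i) = 0)
    (hC1 : ∀ b, ∑ i ∈ Finset.range N,
        (i : ℤ) * (prefixSum (wPair b) X i - prefixSum (wPair b) Z i) =
      ∑ i ∈ Finset.range N,
        (i : ℤ) * (prefixSum (wPair !b) X i - prefixSum (wPair !b) Z i)) :
    (∀ i < N, X i = Z i) ∨
    (∃ b, ∀ j, p + 1 ≤ j → j ≤ Q + 1 →
      ¬ (X j = b ∧ X (j + 1) = b) ∧ ¬ (Z j = b ∧ Z (j + 1) = b)) ∧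
    NegPosNeg fun i => prefixSum wRun X i - prefixSum wRun Z i := by
  -- once all differences of pair counts vanish the sequences are equal
  have fin : ∀ b, (∀ i < N, prefixSum (wPair b) X i - prefixSum (wPair b) Z i = 0) →
      (∀ i < N, prefixSum (wPair !b) X i - prefixSum (wPair !b) Z i = 0) →
      ∀ i < N, X i = Z i := by
    intro b h1 h2 i hi
    refine eq_of_pair_parity h0 (t := 0) ?_
    have h1 := h1 i hi
    have h2 := h2 i hi
    cases b <;> simp only [Bool.not_true, Bool.not_false] at h2 <;> rw [h1, h2] <;> simp
  obtain ⟨b₁, hb₁⟩ : ∃ b, b = del (Q + 1) Z (q + 1) := ⟨_, rfl⟩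
  obtain ⟨b₂, hb₂⟩ : ∃ b, b = Z (Q + 2) := ⟨_, rfl⟩
  obtain ⟨a₁, ha₁⟩ : ∃ b, b = X (p + 1) := ⟨_, rfl⟩
  obtain ⟨a₂, ha₂⟩ : ∃ b, b = del p X (P + 1) := ⟨_, rfl⟩
  have hXZ : X (Q + 3) = Z (Q + 3) := by
    have := congrFun hY (Q + 1)
    rwa [del_of_lt _ (by omega), del_of_lt _ (by omega), del_of_lt _ (by omega),
      del_of_lt _ (by omega)] at this
  have hZq : Z (q + 1) = b₁ := by rw [hb₁, del_of_le _ (by omega)]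
  have hsum : wOne false a₁ + wOne false a₂ = wOne false b₁ + wOne false b₂ := by
    have := (prefixSum_sub_of_separated wOne hpP hPq hqQ hY hQ hM1 rfl rfl rfl rfl).1
    simp only [jump, ← ha₁, ← ha₂, ← hb₁, ← hb₂] at this
    simp only [wOne] at this ⊢
    linarith
  by_cases haa : a₁ = a₂
  · exact Or.inl
      (eq_of_separated_of_eq_bits h0 hpP hPq hqQ hY hQ hM1 hD hb₂ ha₁ ha₂ hXZ hsum haa)
  have ha₂' : a₂ = !a₁ := by revert haa; clear * -; revert a₁ a₂; decide
  have hb₁' : b₁ = !b₂ := by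
    subst ha₂'; revert hsum; clear * -; revert a₁ b₁ b₂; decide
  -- the jumps of the four deletions
  obtain ⟨k₁, hk₁⟩ : ∃ k : Bool → ℤ, ∀ b, k b = jump (wPair b) (X p) (X (p + 1)) (X (p + 2)) :=
    ⟨_, fun _ => rfl⟩
  obtain ⟨k₂, hk₂⟩ : ∃ k : Bool → ℤ, ∀ b,
      k b = jump (wPair b) (del p X P) (del p X (P + 1)) (del p X (P + 2)) := ⟨_, fun _ => rfl⟩
  obtain ⟨l₁, hl₁⟩ : ∃ k : Bool → ℤ, ∀ b, k b = jump (wPair b) (del (Q + 1) Z q)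
      (del (Q + 1) Z (q + 1)) (del (Q + 1) Z (q + 2)) := ⟨_, fun _ => rfl⟩
  obtain ⟨l₂, hl₂⟩ : ∃ k : Bool → ℤ, ∀ b,
      k b = jump (wPair b) (Z (Q + 1)) (Z (Q + 2)) (Z (Q + 3)) := ⟨_, fun _ => rfl⟩
  obtain ⟨C, hCdef⟩ : ∃ C : Bool → ℕ → ℤ, ∀ b i,
      C b i = prefixSum (wPair b) X i - prefixSum (wPair b) Z i := ⟨_, fun _ _ => rfl⟩
  have reg := fun b => prefixSum_sub_of_separated (wPair b) hpP hPq hqQ hY hQ (hM b)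
    (hk₁ b) (hk₂ b) (hl₁ b) (hl₂ b)
  simp only [prefixSum_wRun_sub X Z a₁]
  simp only [← hCdef] at reg hC hC1 fin ⊢
  have J1 := jump_wPair (X p) (X (p + 1)) (X (p + 2))
  have J2 := jump_wPair (del p X P) (del p X (P + 1)) (del p X (P + 2))
  have J3 := jump_wPair (del (Q + 1) Z q) (del (Q + 1) Z (q + 1)) (del (Q + 1) Z (q + 2))
  have J4 := jump_wPair (Z (Q + 1)) (Z (Q + 2)) (Z (Q + 3))
  simp only [← hk₁, ← hk₂, ← hl₁, ← hl₂] at J1 J2 J3 J4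
  rw [← ha₁] at J1
  rw [← ha₂, ha₂', Bool.not_not] at J2
  rw [← hb₁, hb₁', Bool.not_not] at J3
  rw [← hb₂] at J4
  have hw0 := wPair_nonneg
  have hw1 := wPair_le_one
  have cases_i : ∀ i, i ≤ p ∨ (p < i ∧ i ≤ P) ∨ (P < i ∧ i ≤ q) ∨ i = q + 1 ∨
    (q + 2 ≤ i ∧ i ≤ Q + 1) ∨ i = Q + 2 ∨ Q + 3 ≤ i := by intro i; omega
  -- the total jump is the same for `00` and `11`
  have hkk : k₁ (!a₁) + k₂ (!a₁) = k₁ a₁ + k₂ a₁ := by omega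
  have hkl : ∀ b, k₁ b + k₂ b = l₁ b + l₂ b := fun b => (reg b).1
  -- the difference of the numbers of runs at the last deletion
  have hlast1 : l₂ b₂ = -1 → C a₁ (Q + 2) + C (!a₁) (Q + 2) ≥ 0 := by
    intro hl
    have := (reg a₁).2.2.2.2.2.2.1
    rw [this, (reg !a₁).2.2.2.2.2.2.1, ← hb₂]
    have s1 := wPair_add a₁ (X (Q + 2)) (X (Q + 3))
    by_cases hc : Z (Q + 3) = b₂
    · have : wPair a₁ b₂ (Z (Q + 3)) + wPair (!a₁) b₂ (Z (Q + 3)) = 1 := by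
        rw [hc]; clear * -; revert a₁ b₂; decide
      linarith
    · have hd : Z (Q + 1) = b₂ := by
        rcases J4 with h | h
        · exact h.2.2.resolve_right hc
        · omega
      have hqQ' : q < Q := by
        rcases hqQ.eq_or_lt with h | h
        · subst h; rw [hZq, hb₁'] at hd; simp at hd
        · exact h
      have : X (Q + 2) = b₂ := by
        have := congrFun hY Q
        rw [del_of_lt _ (by omega), del_of_lt _ (by omega), del_of_lt _ (by omega),
          del_of_le _ (by omega)] at this
        rw [this, hd]
      rw [this, hXZ]; linarith
  have hlast2 : l₂ b₂ = 0 → C a₁ (Q + 2) + C (!a₁) (Q + 2) ≤ 0 := by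
    intro hl
    rw [(reg a₁).2.2.2.2.2.2.1, (reg !a₁).2.2.2.2.2.2.1, ← hb₂]
    have s1 := wPair_add a₁ (X (Q + 2)) (X (Q + 3))
    have hc : Z (Q + 3) = !b₂ := by
      rcases J4 with h | h
      · omega
      · exact h.2.2.2
    have : wPair a₁ b₂ (Z (Q + 3)) + wPair (!a₁) b₂ (Z (Q + 3)) = 0 := by
      rw [hc]; clear * -; revert a₁ b₂; decide
    linarith
  have hl_sum : l₂ a₁ + l₂ (!a₁) = l₂ b₂ + l₂ (!b₂) := by
    clear * -; cases a₁ <;> cases b₂ <;> simp <;> ring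
  have hk_sum : l₁ a₁ + l₁ (!a₁) = l₁ b₂ + l₁ (!b₂) := by
    clear * -; cases a₁ <;> cases b₂ <;> simp <;> ring
  have hkl1 := hkl a₁
  have hkl2 := hkl (!a₁)
  have r0 := fun b => (reg b).2.1
  have r1 := fun b => (reg b).2.2.1
  have r2 := fun b => (reg b).2.2.2.1
  have r3 := fun b => (reg b).2.2.2.2.1
  have r4 := fun b => (reg b).2.2.2.2.2.1
  have r5 := fun b => (reg b).2.2.2.2.2.2.1
  have r6 := fun b => (reg b).2.2.2.2.2.2.2
  by_cases hneg : k₁ a₁ + k₂ a₁ < 0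
  · -- both deletions in `X` and in `Z` shorten runs: ranks change in one direction only
    left
    have : ∀ i < N, C a₁ i + C (!a₁) i = 0 := by
      refine eq_zero_of_nonneg_of_sum (fun i _ => ?_) ?_
      · have s := wPair_add a₁ (X i) (X (i + 1))
        have s' := wPair_add a₁ (X (i + 1)) (X (i + 2))
        rcases cases_i i with h | h | h | h | h | h | h
        · rw [r0 _ i h, r0 _ i h]; simp
        · rw [r1 _ i h.1 h.2, r1 _ i h.1 h.2]; omega
        · rw [r2 _ i h.1 h.2, r2 _ i h.1 h.2]; omega
        · subst h
          have s := wPair_add a₁ (X (q + 1)) (X (q + 2))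
          have s'' := wPair_add a₁ (Z q) (Z (q + 1))
          rw [r3, r3]; omega
        · rw [r4 _ i h.1 h.2, r4 _ i h.1 h.2]; omega
        · rw [h]; exact hlast1 (by omega)
        · rw [r6 _ i h, r6 _ i h]; simp
      · rw [Finset.sum_add_distrib, hC, hC]; rfl
    intro i hi
    have hi := this i hi
    refine eq_of_pair_parity h0 (t := C true i) ?_
    rw [← hCdef, ← hCdef]
    cases a₁ <;> simp at hi <;> linarith
  -- a last deletion that does not shorten a run of `b` creates no pair `bb` when undone
  have hsign : ∀ b, 0 ≤ l₂ b → C b (Q + 2) ≤ 0 := by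
    intro b hb
    rw [r5]
    have : wPair b (Z (Q + 2)) (Z (Q + 3)) = 0 := by
      rw [hl₂] at hb
      revert hb; generalize Z (Q + 1) = u; generalize Z (Q + 2) = v; generalize Z (Q + 3) = t
      clear * -; revert b u v t; decide
    linarith [hw0 b (X (Q + 2)) (X (Q + 3))]
  have hknn : ∀ b, 0 ≤ k₁ b + k₂ b := by
    intro b
    rcases Bool.eq_or_eq_not b a₁ with h | h <;> rw [h] <;> omega
  -- if neither the first deletion in `X` nor the last one in `Z` shortens a run of `b`, the prefix
  -- count of `bb` is never larger in `X` than in `Z`, hence always equal, which excludes pairs `bb`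
  have target : ∀ b, 0 ≤ k₁ b → 0 ≤ l₂ b → ∃ b, ∀ j, p + 1 ≤ j → j ≤ Q + 1 →
      ¬ (X j = b ∧ X (j + 1) = b) ∧ ¬ (Z j = b ∧ Z (j + 1) = b) := by
    intro b hk hl
    have hk' := hknn b
    have hz : ∀ i < N, C b i = 0 := by
      refine eq_zero_of_nonpos_of_sum (fun i _ => ?_) (hC b)
      have s := hw0 b (X i) (X (i + 1))
      have s' := hw0 b (X (i + 1)) (X (i + 2))
      rcases cases_i i with h | h | h | h | h | h | h
      · rw [r0 _ i h]
      · rw [r1 _ i h.1 h.2]; omega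
      · rw [r2 _ i h.1 h.2]; omega
      · subst h
        have s := hw0 b (X (q + 1)) (X (q + 2))
        have s'' := hw0 b (Z q) (Z (q + 1))
        rw [r3]; omega
      · rw [r4 _ i h.1 h.2]; omega
      · rw [h]; exact hsign b hl
      · rw [r6 _ i h]
    refine ⟨b, fun j hj hj' => ?_⟩
    have hx : wPair b (X j) (X (j + 1)) = 0 := by
      have s := hw0 b (X j) (X (j + 1))
      have s' := hw0 b (X (j + 1)) (X (j + 2))
      have hj0 := hz j (by omega)
      rcases cases_i j with h | h | h | h | h | h | h
      · omega
      · rw [r1 _ j h.1 h.2] at hj0; omega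
      · rw [r2 _ j h.1 h.2] at hj0; omega
      · subst h
        have s := hw0 b (X (q + 1)) (X (q + 2))
        have s'' := hw0 b (Z q) (Z (q + 1))
        rw [r3] at hj0
        change wPair b (X (q + 1)) (X (q + 2)) = 0
        omega
      · rw [r4 _ j h.1 h.2] at hj0; omega
      · omega
      · omega
    have hzz : wPair b (Z j) (Z (j + 1)) = 0 := by
      have e1 := hz j (by omega)
      have e2 := hz (j + 1) (by omega)
      rw [hCdef] at e1 e2
      rw [prefixSum_succ, prefixSum_succ] at e2
      linarith
    simpa [wPair] using And.intro hx hzz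
  by_cases hex : ∃ b, 0 ≤ k₁ b ∧ 0 ≤ l₂ b
  · right
    obtain ⟨b, h1, h2⟩ := hex
    -- the outer parts of the pattern occur if the outermost deletions shorten runs
    refine ⟨target b h1 h2, if k₁ a₁ = -1 then P + 1 else 0,
      if l₂ b₂ = -1 then q + 2 else Q + 3, ?_, ?_, ?_⟩
    · intro i hi
      show -(C a₁ i + C (!a₁) i) ≤ 0
      split_ifs at hi with hc
      · have s := wPair_add a₁ (X i) (X (i + 1))
        rcases le_or_gt i p with h | h
        · rw [r0 _ i h, r0 _ i h]; simp
        · rw [r1 _ i h (by omega), r1 _ i h (by omega)]; omega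
      · omega
    · intro i hi hi'
      show 0 ≤ -(C a₁ i + C (!a₁) i)
      have s := wPair_add a₁ (X i) (X (i + 1))
      have s' := wPair_add a₁ (X (i + 1)) (X (i + 2))
      rcases cases_i i with h | h | h | h | h | h | h
      · rw [r0 _ i h, r0 _ i h]; simp
      · rw [r1 _ i h.1 h.2, r1 _ i h.1 h.2]
        split_ifs at hi <;> omega
      · rw [r2 _ i h.1 h.2, r2 _ i h.1 h.2]; omega
      · subst h
        have s := wPair_add a₁ (X (q + 1)) (X (q + 2))
        have s'' := wPair_add a₁ (Z q) (Z (q + 1))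
        rw [r3, r3]; omega
      · rw [r4 _ i h.1 h.2, r4 _ i h.1 h.2]
        split_ifs at hi' <;> omega
      · subst h
        split_ifs at hi' with hc
        · omega
        · have := hlast2 (by omega)
          omega
      · rw [r6 _ i h, r6 _ i h]; simp
    · intro i _ hi
      show -(C a₁ i + C (!a₁) i) ≤ 0
      split_ifs at hi with hc
      · have s := wPair_add a₁ (X i) (X (i + 1))
        rcases cases_i i with h | h | h | h | h | h | h
        · omega
        · omega
        · omega
        · omega
        · rw [r4 _ i h.1 h.2, r4 _ i h.1 h.2]; omega
        · have := hlast1 hc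
          subst h; omega
        · rw [r6 _ i h, r6 _ i h]; simp
      · rw [r6 _ i hi, r6 _ i hi]; simp
  · -- the first deletion in `X` shortens a run of `a₁` and the last one in `Z` a run of `!a₁`: both
    -- differences of pair counts change sign once, in opposite directions, and their first moments
    -- are equal
    left
    push Not at hex
    have e1 : k₁ a₁ = -1 := by
      have := hex a₁
      by_contra hne
      have h3 : b₂ = a₁ := by
        by_contra h
        have : b₂ = !a₁ := by revert h; clear * -; revert a₁ b₂; decide
        rw [this, Bool.not_not] at J4
        have := hex a₁ (by omega)
        omega
      rw [h3] at J4
      have := hex (!a₁) (by omega)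
      omega
    have e2 : b₂ = !a₁ := by
      by_contra h
      have : b₂ = a₁ := by revert h; clear * -; revert a₁ b₂; decide
      rw [this] at J4
      have := hex (!a₁) (by omega)
      omega
    have e3 : l₂ (!a₁) = -1 := by
      have := hex (!a₁) (by omega)
      rw [e2, Bool.not_not] at J4
      omega
    rw [e2, Bool.not_not] at J4
    have c1 : ∀ i < N, i < P + 1 → - C a₁ i ≤ 0 := by
      intro i _ hi
      rcases le_or_gt i p with h | h
      · rw [r0 _ i h]; simp
      · rw [r1 _ i h (by omega)]
        have := hw1 a₁ (X i) (X (i + 1))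
        omega
    have c2 : ∀ i < N, P + 1 ≤ i → 0 ≤ - C a₁ i := by
      intro i _ hi
      have s := hw0 a₁ (X i) (X (i + 1))
      have s' := hw0 a₁ (X (i + 1)) (X (i + 2))
      rcases cases_i i with h | h | h | h | h | h | h
      · omega
      · omega
      · rw [r2 _ i h.1 h.2]; omega
      · subst h
        have s := hw0 a₁ (X (q + 1)) (X (q + 2))
        have s'' := hw0 a₁ (Z q) (Z (q + 1))
        rw [r3]; omega
      · rw [r4 _ i h.1 h.2]; omega
      · have := hsign a₁ (by omega)
        subst h; omega
      · rw [r6 _ i h]; simp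
    have d1 : ∀ i < N, i < q + 2 → C (!a₁) i ≤ 0 := by
      intro i _ hi
      have s := hw0 (!a₁) (X i) (X (i + 1))
      have s' := hw0 (!a₁) (X (i + 1)) (X (i + 2))
      rcases cases_i i with h | h | h | h | h | h | h
      · rw [r0 _ i h]
      · rw [r1 _ i h.1 h.2]; omega
      · rw [r2 _ i h.1 h.2]; omega
      · subst h
        have s := hw0 (!a₁) (X (q + 1)) (X (q + 2))
        have s'' := hw0 (!a₁) (Z q) (Z (q + 1))
        rw [r3]; omega
      · omega
      · omega
      · omega
    have d2 : ∀ i < N, q + 2 ≤ i → 0 ≤ C (!a₁) i := by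
      intro i _ hi
      have s := hw1 (!a₁) (X i) (X (i + 1))
      rcases cases_i i with h | h | h | h | h | h | h
      · omega
      · omega
      · omega
      · omega
      · rw [r4 _ i h.1 h.2]; omega
      · rw [h, r5, hXZ, ← hb₂, e2]
        have : ∀ u v b : Bool, wPair b u v ≤ wPair b b v := by decide
        linarith [this (X (Q + 2)) (Z (Q + 3)) (!a₁)]
      · rw [r6 _ i h]
    have hCn : ∑ i ∈ Finset.range N, - C a₁ i = 0 := by simp [hC]
    have m1 := first_moment_nonneg hCn c1 c2
    have m2 := first_moment_nonneg (hC _) d1 d2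
    have m3 := hC1 a₁
    have m1' : ∑ i ∈ Finset.range N, (i : ℤ) * - C a₁ i =
        - ∑ i ∈ Finset.range N, (i : ℤ) * C a₁ i := by simp
    have z1 := eq_zero_of_moments hCn c1 c2 (by linarith)
    have z2 := eq_zero_of_moments (hC _) d1 d2 (by linarith)
    exact fin a₁ (fun i hi => by linarith [z1 i hi]) z2

/-! ### From strings to bit sequences -/

@[simp] theorem bit_zero (x : List Bool) : bit x 0 = false := rfl

theorem bit_succ (x : List Bool) (i : ℕ) : bit x (i + 1) = x.getD i true := by
  rcases lt_or_ge i x.length with h | h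
  · simp [bit, ext, List.getD_eq_getElem?_getD, List.getElem?_append_left h]
  · simp only [bit, ext, List.getD_eq_getElem?_getD, List.getElem?_cons_succ,
      List.getElem?_append_right h, List.getElem?_eq_none h]
    cases hi : i - x.length <;> simp

theorem bit_of_length_lt {x : List Bool} {i : ℕ} (h : x.length < i) : bit x i = true := by
  obtain ⟨j, rfl⟩ : ∃ j, i = j + 1 := ⟨i - 1, by omega⟩
  rw [bit_succ, List.getD_eq_default _ _ (by omega)]

theorem bit_eraseIdx (x : List Bool) (p : ℕ) : bit (x.eraseIdx p) = del p (bit x) := by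
  funext i
  rcases i with _ | i
  · simp [del]
  · simp only [del, bit_succ, List.getD_eq_getElem?_getD, List.getElem?_eraseIdx]
    split_ifs <;> first | rfl | omega

theorem list_eq_of_bit {x z : List Bool} (hl : x.length = z.length)
    (h : ∀ i < x.length + 2, bit x i = bit z i) : x = z := by
  refine List.ext_getElem hl fun i h1 h2 => ?_
  have := h (i + 1) (by omega)
  rwa [bit_succ, bit_succ, List.getD_eq_getElem _ _ h1, List.getD_eq_getElem _ _ h2] at this

theorem exists_eraseIdx_of_sublist {y x : List Bool} (h : y.Sublist x)
    (hl : y.length < x.length) : ∃ p < x.length, y.Sublist (x.eraseIdx p) := by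
  induction h with
  | slnil => simp at hl
  | cons a h _ => exact ⟨0, by simp, by simpa using h⟩
  | cons_cons a h ih =>
    obtain ⟨p, hp, h'⟩ := ih (by simpa using hl)
    exact ⟨p + 1, by simpa using hp, by simpa using h'⟩

/-- A subsequence obtained by two deletions, with the deletions ordered from left to right. -/
theorem exists_del_del {x y : List Bool} (h : y.Sublist x) (hl : y.length + 2 = x.length) :
    ∃ p P, p ≤ P ∧ P + 2 ≤ x.length ∧ bit y = del P (del p (bit x)) := by
  obtain ⟨a, ha, h1⟩ := exists_eraseIdx_of_sublist h (by omega)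
  have l1 : (x.eraseIdx a).length + 1 = x.length := by
    rw [List.length_eraseIdx_of_lt ha]; omega
  obtain ⟨b, hb, h2⟩ := exists_eraseIdx_of_sublist h1 (by omega)
  have l2 : ((x.eraseIdx a).eraseIdx b).length + 1 = (x.eraseIdx a).length := by
    rw [List.length_eraseIdx_of_lt hb]; omega
  have h3 : bit y = del b (del a (bit x)) := by
    rw [h2.eq_of_length (by omega), bit_eraseIdx, bit_eraseIdx]
  rcases le_or_gt a b with hab | hab
  · exact ⟨a, b, hab, by omega, h3⟩
  · obtain ⟨a', rfl⟩ : ∃ a', a = a' + 1 := ⟨a - 1, by omega⟩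
    exact ⟨b, a', by omega, by omega, by rw [h3, del_del_comm _ (by omega)]⟩

theorem cast_rank (x : List Bool) (i : ℕ) : (rank x i : ℤ) = prefixSum wRun (bit x) i := by
  induction i with
  | zero => simp [rank]
  | succ i ih =>
    rw [prefixSum_succ, ← ih, rank, wRun]
    split_ifs <;> simp

theorem sum_range_getD (f : Bool → ℤ) (x : List Bool) :
    ∑ j ∈ Finset.range x.length, f (x.getD j true) = (x.map f).sum := by
  induction x with
  | nil => simp
  | cons a x ih =>
    rw [List.length_cons, Finset.sum_range_succ', List.map_cons, List.sum_cons, ← ih, add_comm]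
    simp

theorem cast_numOnes (x : List Bool) : (numOnes x : ℤ) = prefixSum wOne (bit x) x.length := by
  have h1 : prefixSum wOne (bit x) x.length =
      ∑ j ∈ Finset.range x.length, wOne false (x.getD j true) :=
    Finset.sum_congr rfl fun j _ => by rw [bit_succ]; rfl
  rw [h1, sum_range_getD, numOnes]
  clear h1
  induction x with
  | nil => simp
  | cons a x ih => cases a <;> simp_all [wOne, add_comm]

/-- Summation by parts: the sum of the differences of the prefix counts of ones in terms of the
differences of the bits. -/
theorem sum_prefixSum_wOne (X Z : ℕ → Bool) (N : ℕ) :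
    ∑ i ∈ Finset.range (N + 1), (prefixSum wOne X i - prefixSum wOne Z i) +
      ∑ j ∈ Finset.range (N + 1), (j : ℤ) * (wOne false (X j) - wOne false (Z j)) =
    (N + 1) * (prefixSum wOne X N - prefixSum wOne Z N) := by
  induction N with
  | zero => simp
  | succ N ih =>
    rw [Finset.sum_range_succ, Finset.sum_range_succ _ (N + 1), prefixSum_succ wOne X,
      prefixSum_succ wOne Z]
    rw [show wOne (X N) (X (N + 1)) = wOne false (X (N + 1)) from rfl,
      show wOne (Z N) (Z (N + 1)) = wOne false (Z (N + 1)) from rfl]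
    push_cast
    linear_combination ih

/-- The first moments of these differences. -/
theorem sum_mul_prefixSum_wOne (X Z : ℕ → Bool) (N : ℕ) :
    ∑ i ∈ Finset.range (N + 1), (i : ℤ) * (prefixSum wOne X i - prefixSum wOne Z i) +
      ∑ j ∈ Finset.range (N + 1), (j.choose 2 : ℤ) * (wOne false (X j) - wOne false (Z j)) =
    ((N + 1).choose 2 : ℤ) * (prefixSum wOne X N - prefixSum wOne Z N) := by
  induction N with
  | zero => simp
  | succ N ih =>
    rw [Finset.sum_range_succ, Finset.sum_range_succ _ (N + 1), prefixSum_succ wOne X,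
      prefixSum_succ wOne Z]
    rw [show wOne (X N) (X (N + 1)) = wOne false (X (N + 1)) from rfl,
      show wOne (Z N) (Z (N + 1)) = wOne false (Z (N + 1)) from rfl]
    have : ((N + 1 + 1).choose 2 : ℤ) = (N + 1 : ℤ) + ((N + 1).choose 2 : ℤ) := by
      rw [Nat.choose_succ_succ' (N + 1) 1]; push_cast; simp
    rw [this]
    push_cast
    linear_combination ih

theorem sum_range_eq_sum_Icc (g : ℕ → ℤ) (n : ℕ) (h0 : g 0 = 0) (h1 : g (n + 1) = 0) :
    ∑ j ∈ Finset.range (n + 2), g j = ∑ j ∈ Finset.Icc 1 n, g j := by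
  rw [Finset.sum_range_succ, h1, add_zero, Finset.range_eq_Ico,
    Finset.sum_eq_sum_Ico_succ_bot (by omega), h0, zero_add]
  rfl

theorem toNat_eq_wOne (b : Bool) : (b.toNat : ℤ) = wOne false b := by cases b <;> rfl

theorem cast_f1_sub {x z : List Bool} (hl : x.length = z.length) :
    (f1 x : ℤ) - f1 z = ∑ j ∈ Finset.range (x.length + 2),
      (j : ℤ) * (wOne false (bit x j) - wOne false (bit z j)) := by
  rw [sum_range_eq_sum_Icc _ _ (by simp)
    (by rw [bit_of_length_lt (by omega), bit_of_length_lt (by omega)]; simp)]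
  simp only [f1, hl]
  push_cast
  rw [← Finset.sum_sub_distrib]
  exact Finset.sum_congr rfl fun j _ => by rw [toNat_eq_wOne, toNat_eq_wOne]; ring

theorem cast_f2_sub {x z : List Bool} (hl : x.length = z.length) :
    (f2 x : ℤ) - f2 z = ∑ j ∈ Finset.range (x.length + 2),
      (j.choose 2 : ℤ) * (wOne false (bit x j) - wOne false (bit z j)) := by
  rw [sum_range_eq_sum_Icc _ _ (by simp)
    (by rw [bit_of_length_lt (by omega), bit_of_length_lt (by omega)]; simp)]
  simp only [f2, hl]
  push_cast
  rw [← Finset.sum_sub_distrib]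
  exact Finset.sum_congr rfl fun j _ => by rw [toNat_eq_wOne, toNat_eq_wOne]; ring

theorem cast_f1r_sub {x z : List Bool} (hl : x.length = z.length) :
    (f1r x : ℤ) - f1r z = ∑ j ∈ Finset.range (x.length + 2),
      (prefixSum wRun (bit x) j - prefixSum wRun (bit z) j) := by
  simp only [f1r, hl, ← cast_rank]
  push_cast
  rw [← Finset.sum_sub_distrib, Finset.range_eq_Ico,
    Finset.sum_eq_sum_Ico_succ_bot (by omega)]
  simp only [rank, Nat.cast_zero, sub_zero, zero_add]
  rfl

theorem two_mul_wOne_sub {X Z : ℕ → Bool} (h0 : X 0 = Z 0) (i : ℕ) :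
    2 * (prefixSum wOne X i - prefixSum wOne Z i) =
      (prefixSum (wPair true) X i - prefixSum (wPair true) Z i) -
      (prefixSum (wPair false) X i - prefixSum (wPair false) Z i) +
      (wOne false (X i) - wOne false (Z i)) := by
  rw [mul_sub, two_mul_prefixSum_wOne, two_mul_prefixSum_wOne, h0]
  ring

/-- The moments known for ones and runs determine those of the pair counts. -/
theorem sum_wPair_sub {X Z : ℕ → Bool} (h0 : X 0 = Z 0) {N : ℕ}
    (hD : ∑ i ∈ Finset.range N, (prefixSum wOne X i - prefixSum wOne Z i) = 0)
    (hδ : ∑ i ∈ Finset.range N, (wOne false (X i) - wOne false (Z i)) = 0)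
    (hR : ∑ i ∈ Finset.range N, (prefixSum wRun X i - prefixSum wRun Z i) = 0) (b : Bool) :
    ∑ i ∈ Finset.range N, (prefixSum (wPair b) X i - prefixSum (wPair b) Z i) = 0 := by
  have e1 : 2 * ∑ i ∈ Finset.range N, (prefixSum wOne X i - prefixSum wOne Z i) =
      ∑ i ∈ Finset.range N, (prefixSum (wPair true) X i - prefixSum (wPair true) Z i) -
      ∑ i ∈ Finset.range N, (prefixSum (wPair false) X i - prefixSum (wPair false) Z i) +
      ∑ i ∈ Finset.range N, (wOne false (X i) - wOne false (Z i)) := by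
    rw [Finset.mul_sum, ← Finset.sum_sub_distrib, ← Finset.sum_add_distrib]
    exact Finset.sum_congr rfl fun i _ => two_mul_wOne_sub h0 i
  have e2 : ∑ i ∈ Finset.range N, (prefixSum wRun X i - prefixSum wRun Z i) =
      -(∑ i ∈ Finset.range N, (prefixSum (wPair true) X i - prefixSum (wPair true) Z i) +
      ∑ i ∈ Finset.range N, (prefixSum (wPair false) X i - prefixSum (wPair false) Z i)) := by
    rw [← Finset.sum_add_distrib, ← Finset.sum_neg_distrib]
    exact Finset.sum_congr rfl fun i _ => prefixSum_wRun_sub X Z true i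
  rw [hD, hδ] at e1
  rw [hR] at e2
  cases b <;> linarith

/-- The first moments of the pair counts of `00` and of `11` change by the same amount. -/
theorem sum_mul_wPair_sub {X Z : ℕ → Bool} (h0 : X 0 = Z 0) {N : ℕ}
    (hD : ∑ i ∈ Finset.range N, (i : ℤ) * (prefixSum wOne X i - prefixSum wOne Z i) = 0)
    (hδ : ∑ i ∈ Finset.range N, (i : ℤ) * (wOne false (X i) - wOne false (Z i)) = 0) (b : Bool) :
    ∑ i ∈ Finset.range N, (i : ℤ) * (prefixSum (wPair b) X i - prefixSum (wPair b) Z i) =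
    ∑ i ∈ Finset.range N, (i : ℤ) * (prefixSum (wPair !b) X i - prefixSum (wPair !b) Z i) := by
  have e1 : 2 * ∑ i ∈ Finset.range N, (i : ℤ) * (prefixSum wOne X i - prefixSum wOne Z i) =
      ∑ i ∈ Finset.range N, (i : ℤ) * (prefixSum (wPair true) X i - prefixSum (wPair true) Z i) -
      ∑ i ∈ Finset.range N, (i : ℤ) * (prefixSum (wPair false) X i - prefixSum (wPair false) Z i) +
      ∑ i ∈ Finset.range N, (i : ℤ) * (wOne false (X i) - wOne false (Z i)) := by
    rw [Finset.mul_sum, ← Finset.sum_sub_distrib, ← Finset.sum_add_distrib]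
    refine Finset.sum_congr rfl fun i _ => ?_
    rw [mul_left_comm, two_mul_wOne_sub h0 i]
    ring
  rw [hD, hδ] at e1
  cases b <;> simp only [Bool.not_true, Bool.not_false] <;> linarith

/-! ### The global part of the sketch -/

/-- The bits of `x` and `z` agree outside the window of positions `A, …, B`, for some bit `b` the
window contains a pair `bb` neither in `x` nor in `z`, and the difference of the ranks has sign
pattern `-`, `+`, `-`. -/
def CloseStrings (x z : List Bool) : Prop :=
  ∃ A B, 1 ≤ A ∧ A ≤ B ∧ B ≤ x.length ∧ (∀ i, i < A ∨ B < i → bit x i = bit z i) ∧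
    (∃ b, ∀ j, A ≤ j → j < B →
      ¬ (bit x j = b ∧ bit x (j + 1) = b) ∧ ¬ (bit z j = b ∧ bit z (j + 1) = b)) ∧
    NegPosNeg fun i => (rank x i : ℤ) - rank z i

/-- The case in which the first of all deletions is one in `x`. -/
theorem eq_or_closeStrings_aux {x z : List Bool} (hl : x.length = z.length) {p P q Q : ℕ}
    (hpP : p ≤ P) (hP : P + 2 ≤ x.length) (hqQ : q ≤ Q) (hQ : Q + 2 ≤ x.length) (hpq : p ≤ q)
    (hY : del P (del p (bit x)) = del Q (del q (bit z)))
    (h1 : f1 x = f1 z) (h2 : f2 x = f2 z) (h1r : f1r x = f1r z) (ho : numOnes x = numOnes z)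
    (hr : numRuns x = numRuns z) : x = z ∨ CloseStrings x z := by
  have hN : bit x (x.length + 1) = bit z (x.length + 1) := by
    rw [bit_of_length_lt (by omega), bit_of_length_lt (by omega)]
  have eo : prefixSum wOne (bit x) (x.length + 1) = prefixSum wOne (bit z) (x.length + 1) := by
    have : (numOnes x : ℤ) = numOnes z := by rw [ho]
    rw [cast_numOnes, cast_numOnes, ← hl] at this
    rw [prefixSum_succ, prefixSum_succ, this, hN]; rfl
  have er : prefixSum wRun (bit x) (x.length + 1) = prefixSum wRun (bit z) (x.length + 1) := by
    rw [← cast_rank, ← cast_rank]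
    have : rank x (x.length + 1) + 1 = rank z (z.length + 1) + 1 := hr
    rw [← hl] at this
    have h := Nat.succ_injective this
    rw [h]
  have s1 := cast_f1_sub hl
  have s2 := cast_f2_sub hl
  have s3 := cast_f1r_sub hl
  rw [h1, sub_self] at s1
  rw [h2, sub_self] at s2
  rw [h1r, sub_self] at s3
  have hD := sum_prefixSum_wOne (bit x) (bit z) (x.length + 1)
  have hD1 := sum_mul_prefixSum_wOne (bit x) (bit z) (x.length + 1)
  rw [← s1, eo, sub_self, mul_zero, add_zero] at hD
  rw [← s2, eo, sub_self, mul_zero, add_zero] at hD1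
  rcases le_or_gt q P with hqP | hPq
  · exact Or.inl (list_eq_of_bit hl (eq_of_interleaved rfl hpq hqP hqQ hY (M := x.length + 1)
      (by omega) (by omega) eo hD hD1))
  have sδ : ∑ j ∈ Finset.range (x.length + 2),
      (wOne false (bit x j) - wOne false (bit z j)) = 0 := by
    rw [Finset.sum_range_succ', ← sub_self (prefixSum wOne (bit z) (x.length + 1))]
    nth_rw 1 [← eo]
    rw [prefixSum, prefixSum, ← Finset.sum_sub_distrib]
    simp [wOne]
  have hC := sum_wPair_sub (X := bit x) (Z := bit z) rfl hD sδ s3.symm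
  have hC1 := sum_mul_wPair_sub (X := bit x) (Z := bit z) rfl hD1 s1.symm
  have hM : ∀ b, prefixSum (wPair b) (bit x) (x.length + 1) =
      prefixSum (wPair b) (bit z) (x.length + 1) := by
    have i2 := two_mul_wOne_sub (X := bit x) (Z := bit z) rfl (x.length + 1)
    have ir := prefixSum_wRun_sub (bit x) (bit z) true (x.length + 1)
    rw [hN, eo] at i2
    rw [er] at ir
    intro b; cases b <;> simp at i2 ir ⊢ <;> linarith
  have hY' : del P (del p (bit x)) = del q (del (Q + 1) (bit z)) := by
    rw [hY, del_del_comm _ hqQ]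
  rcases eq_of_separated (X := bit x) (Z := bit z) (M := x.length + 1) (N := x.length + 2)
    (bit_zero x) hpP hPq hqQ hY' (by omega)
    (by omega) hM eo hD hC hC1 with h | ⟨⟨b, hb⟩, hpat⟩
  · exact Or.inl (list_eq_of_bit hl h)
  · refine Or.inr ⟨p + 1, Q + 2, by omega, by omega, hQ, ?_, ⟨b, fun j h h' =>
      hb j h (by omega)⟩, ?_⟩
    swap
    · simp only [cast_rank]
      exact hpat
    rintro i (hi | hi)
    · have := congrFun hY' i
      rwa [del_of_le _ (by omega), del_of_le _ (by omega), del_of_le _ (by omega),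
        del_of_le _ (by omega)] at this
    · obtain ⟨k, rfl⟩ : ∃ k, i = k + 2 := ⟨i - 2, by omega⟩
      have := congrFun hY' k
      rwa [del_of_lt _ (by omega), del_of_lt _ (by omega), del_of_lt _ (by omega),
        del_of_lt _ (by omega)] at this

/-- Strings with a common subsequence and equal global sketches are equal or close. -/
theorem eq_or_closeStrings {x y z : List Bool} (hl : x.length = z.length) (hyx : y.Sublist x)
    (hyz : y.Sublist z) (hy : y.length + 2 = x.length)
    (h1 : f1 x = f1 z) (h2 : f2 x = f2 z) (h1r : f1r x = f1r z) (ho : numOnes x = numOnes z)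
    (hr : numRuns x = numRuns z) : x = z ∨ CloseStrings x z ∨ CloseStrings z x := by
  obtain ⟨p, P, hpP, hP, hx⟩ := exists_del_del hyx hy
  obtain ⟨q, Q, hqQ, hQ, hz⟩ := exists_del_del hyz (by omega)
  rcases le_total p q with h | h
  · rcases eq_or_closeStrings_aux hl hpP hP hqQ (by omega) h (hx.symm.trans hz) h1 h2 h1r ho hr
      with h | h
    · exact Or.inl h
    · exact Or.inr (Or.inl h)
  · rcases eq_or_closeStrings_aux hl.symm hqQ hQ hpP (by omega) h (hz.symm.trans hx) h1.symm
      h2.symm h1r.symm ho.symm hr.symm with h | h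
    · exact Or.inl h.symm
    · exact Or.inr (Or.inr h)

/-! ### Strings with close ranks are determined by three moments of the ranks -/

/-- The value at `v` of the cubic polynomial that vanishes at `0` and whose increment at `t` is
`(2 (t - T₁) + 1) (2 (t - T₂) + 1)`. -/
def cubic (T₁ T₂ : ℤ) (v : ℕ) : ℤ :=
  8 * (v.choose 3 : ℤ) + (8 - 4 * T₁ - 4 * T₂) * (v.choose 2 : ℤ) +
    (1 - 2 * T₁) * (1 - 2 * T₂) * v

theorem cubic_succ (T₁ T₂ : ℤ) (t : ℕ) :
    cubic T₁ T₂ (t + 1) = cubic T₁ T₂ t + (2 * ((t : ℤ) - T₁) + 1) * (2 * ((t : ℤ) - T₂) + 1) := by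
  have h2 : ((t.choose 2 : ℕ) : ℤ) * 2 = t * (t - 1) := by
    induction t with
    | zero => simp
    | succ t ih =>
      rw [Nat.choose_succ_succ' t 1, Nat.choose_one_right]
      push_cast; linear_combination ih
  simp only [cubic, Nat.choose_succ_succ' t 2, Nat.choose_succ_succ' t 1, Nat.choose_one_right]
  push_cast
  linear_combination 4 * h2

theorem sub_le_cubic_sub {T₁ T₂ : ℤ} {r s : ℕ} (h : r ≤ s)
    (hw : ∀ t : ℕ, r ≤ t → t < s → 0 < (2 * ((t : ℤ) - T₁) + 1) * (2 * ((t : ℤ) - T₂) + 1)) :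
    (s : ℤ) - r ≤ cubic T₁ T₂ s - cubic T₁ T₂ r := by
  induction s, h using Nat.le_induction with
  | base => simp
  | succ s hs ih =>
    have h1 := ih fun t h h' => hw t h (by omega)
    have h2 := hw s hs (by omega)
    rw [cubic_succ]
    push_cast
    linarith

theorem cubic_sub_le_sub {T₁ T₂ : ℤ} {r s : ℕ} (h : r ≤ s)
    (hw : ∀ t : ℕ, r ≤ t → t < s → (2 * ((t : ℤ) - T₁) + 1) * (2 * ((t : ℤ) - T₂) + 1) < 0) :
    cubic T₁ T₂ s - cubic T₁ T₂ r ≤ (r : ℤ) - s := by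
  induction s, h using Nat.le_induction with
  | base => simp
  | succ s hs ih =>
    have h1 := ih fun t h h' => hw t h (by omega)
    have h2 := hw s hs (by omega)
    rw [cubic_succ]
    push_cast
    linarith

/-- Two monotone sequences whose difference has the sign pattern `-`, `+`, `-` are equal if their
first three moments are. The moments are combined to a cubic polynomial that increases up to the
value at the first sign change, decreases up to the value at the second one, and increases from
there on. -/
theorem eq_of_moments {r s : ℕ → ℕ} (hr : Monotone r) (hs : Monotone s) {I : Finset ℕ}
    (h1 : ∑ i ∈ I, (r i : ℤ) = ∑ i ∈ I, (s i : ℤ))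
    (h2 : ∑ i ∈ I, ((r i).choose 2 : ℤ) = ∑ i ∈ I, ((s i).choose 2 : ℤ))
    (h3 : ∑ i ∈ I, ((r i).choose 3 : ℤ) = ∑ i ∈ I, ((s i).choose 3 : ℤ))
    (hp : NegPosNeg fun i => (r i : ℤ) - s i) : ∀ i ∈ I, r i = s i := by
  obtain ⟨i₁, i₂, p1, p2, p3⟩ := hp
  dsimp only at p1 p2 p3
  rcases lt_or_ge i₁ i₂ with h12 | h12
  · have hc : ∀ T₁ T₂ : ℤ, ∑ i ∈ I, (cubic T₁ T₂ (s i) - cubic T₁ T₂ (r i)) = 0 := by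
      intro T₁ T₂
      simp only [cubic]
      rw [Finset.sum_sub_distrib]
      simp only [Finset.sum_add_distrib, ← Finset.mul_sum, h1, h2, h3, sub_self]
    have hT : s i₁ ≤ r i₂ := by
      have := p2 i₁ le_rfl h12
      have := hr h12.le
      omega
    have key : ∀ i, |(r i : ℤ) - s i| ≤
        cubic (s i₁) (r i₂) (s i) - cubic (s i₁) (r i₂) (r i) := by
      intro i
      rcases lt_or_ge i i₁ with h | h
      · have hle := p1 i h
        rw [abs_of_nonpos hle]
        have := hs h.le
        have := sub_le_cubic_sub (T₁ := s i₁) (T₂ := r i₂) (r := r i) (s := s i) (by omega)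
          fun t ht ht' => mul_pos_of_neg_of_neg (by omega) (by omega)
        linarith
      · rcases lt_or_ge i i₂ with h' | h'
        · have hle := p2 i h h'
          rw [abs_of_nonneg hle]
          have := hs h
          have := hr h'.le
          have := cubic_sub_le_sub (T₁ := s i₁) (T₂ := r i₂) (r := s i) (s := r i) (by omega)
            fun t ht ht' => mul_neg_of_pos_of_neg (by omega) (by omega)
          linarith
        · have hle := p3 i h h'
          rw [abs_of_nonpos hle]
          have := hr h'
          have := sub_le_cubic_sub (T₁ := s i₁) (T₂ := r i₂) (r := r i) (s := s i) (by omega)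
            fun t ht ht' => mul_pos (by omega) (by omega)
          linarith
    intro i hi
    have := (Finset.sum_eq_zero_iff_of_nonneg fun i _ => (abs_nonneg _).trans (key i)).1
      (hc (s i₁) (r i₂)) i hi
    have h0 := key i
    rw [this] at h0
    have := abs_nonpos_iff.1 h0
    omega
  · intro i hi
    have hle : ∀ i, (r i : ℤ) - s i ≤ 0 := fun i =>
      (lt_or_ge i i₁).elim (p1 i) fun h => p3 i h (by omega)
    have := (Finset.sum_eq_zero_iff_of_nonpos fun i _ => hle i).1
      (by rw [Finset.sum_sub_distrib, h1, sub_self]) i hi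
    omega

theorem rank_mono (x : List Bool) : Monotone (rank x) := by
  refine monotone_nat_of_le_succ fun i => ?_
  rw [rank]; split_ifs <;> omega

theorem rank_le (x : List Bool) (i : ℕ) : rank x i ≤ i := by
  induction i with
  | zero => simp [rank]
  | succ i ih => rw [rank]; split_ifs <;> omega

/-! ### Ranks within a block -/

theorem bit_block (x : List Bool) (s L : ℕ) {i : ℕ} (h0 : 1 ≤ i)
    (h : i ≤ ((x.drop s).take L).length) : bit ((x.drop s).take L) i = bit x (s + i) := by
  obtain ⟨j, rfl⟩ : ∃ j, i = j + 1 := ⟨i - 1, by omega⟩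
  rw [← add_assoc, bit_succ, bit_succ]
  simp only [List.length_take, List.length_drop] at h
  rw [List.getD_eq_getElem?_getD, List.getD_eq_getElem?_getD, List.getElem?_take,
    if_pos (by omega), List.getElem?_drop]

/-- The jump of the rank, as an integer. -/
theorem rank_succ (x : List Bool) (i : ℕ) :
    (rank x (i + 1) : ℤ) = rank x i + wRun (bit x i) (bit x (i + 1)) := by
  rw [rank, wRun]; split_ifs <;> simp

theorem rank_eq_of_lt {x z : List Bool} {A i : ℕ} (h : ∀ i, i < A → bit x i = bit z i)
    (hi : i < A) : (rank x i : ℤ) - rank z i = 0 := by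
  rw [cast_rank, cast_rank, prefixSum_congr fun j hj => h j (by omega), sub_self]

theorem rank_eq_of_gt {x z : List Bool} {B i : ℕ} (hl : x.length = z.length)
    (h : ∀ i, B < i → bit x i = bit z i) (hB : B ≤ x.length)
    (hr : numRuns x = numRuns z) (hi : B < i) : (rank x i : ℤ) - rank z i = 0 := by
  have key : ∀ i, B + 1 ≤ i →
      (rank x i : ℤ) - rank z i = (rank x (B + 1) : ℤ) - rank z (B + 1) := by
    intro i hi
    induction i, hi using Nat.le_induction with
    | base => rfl
    | succ i hi ih => rw [rank_succ, rank_succ, h i (by omega), h (i + 1) (by omega)]; linarith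
  rw [key i hi, ← key (x.length + 1) (by omega)]
  have : rank x (x.length + 1) + 1 = rank z (z.length + 1) + 1 := hr
  rw [← hl] at this
  omega

/-- If two strings agree at the ends of a block, or the block reaches the end of the string, then
differences of ranks are the same in the strings and in the blocks. -/
theorem rank_block_sub {x z : List Bool} {A B s L : ℕ} (hl : x.length = z.length) (hA : 1 ≤ A)
    (hout : ∀ i, i < A ∨ B < i → bit x i = bit z i) (hB : B ≤ x.length)
    (hr : numRuns x = numRuns z) (hs : s + 2 ≤ A ∨ s = 0) (hsx : s < x.length)
    (hL : B + 1 ≤ s + L ∨ x.length ≤ s + L) (hL0 : 1 ≤ L) (i : ℕ) :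
    (rank ((x.drop s).take L) i : ℤ) - rank ((z.drop s).take L) i =
      (rank x (s + i) : ℤ) - rank z (s + i) := by
  have lu : ((x.drop s).take L).length = min L (x.length - s) := by simp
  have lv : ((z.drop s).take L).length = min L (x.length - s) := by simp [hl]
  have bu := fun i => bit_block x s L (i := i)
  have bv := fun i => bit_block z s L (i := i)
  obtain ⟨m, hm⟩ : ∃ m, m = min L (x.length - s) := ⟨_, rfl⟩
  rw [← hm] at lu lv
  rw [lu] at bu
  rw [lv] at bv
  have hF1 : ∀ i, i < A → (rank x i : ℤ) - rank z i = 0 :=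
    fun i hi => rank_eq_of_lt (fun i hi => hout i (Or.inl hi)) hi
  have hF2 : ∀ i, B < i → (rank x i : ℤ) - rank z i = 0 :=
    fun i hi => rank_eq_of_gt hl (fun i hi => hout i (Or.inr hi)) hB hr hi
  have h0 : (rank x s : ℤ) - rank z s = 0 := hF1 s (by omega)
  have inside : ∀ i, 1 ≤ i → i ≤ m →
      (rank ((x.drop s).take L) i : ℤ) - rank ((z.drop s).take L) i =
        (rank x (s + i) : ℤ) - rank z (s + i) := by
    intro i hi
    induction i, hi using Nat.le_induction with
    | base =>
      intro h
      rw [rank_succ, rank_succ, rank_succ, rank_succ, zero_add, bu 1 le_rfl h, bv 1 le_rfl h]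
      rcases hs with hs | rfl
      · rw [hout s (by omega), hout (s + 1) (by omega)]
        simp only [rank, bit_zero]; linarith
      · simp [rank]
    | succ i hi ih =>
      intro h
      have := ih (by omega)
      rw [rank_succ, rank_succ, ← add_assoc, rank_succ, rank_succ, bu i hi (by omega),
        bu (i + 1) (by omega) h, bv i hi (by omega), bv (i + 1) (by omega) h]
      rw [add_assoc]
      linarith
  have hm1 : 1 ≤ m := by omega
  have tu : ∀ i, m < i → bit ((x.drop s).take L) i = true :=
    fun i hi => bit_of_length_lt (by omega)
  have tv : ∀ i, m < i → bit ((z.drop s).take L) i = true :=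
    fun i hi => bit_of_length_lt (by omega)
  have last : (rank ((x.drop s).take L) (m + 1) : ℤ) - rank ((z.drop s).take L) (m + 1) = 0 := by
    have hi := inside m hm1 le_rfl
    rw [rank_succ, rank_succ, bu m hm1 le_rfl, bv m hm1 le_rfl, tu _ (Nat.lt_succ_self m),
      tv _ (Nat.lt_succ_self m)]
    by_cases hc : B < s + m
    · rw [hout (s + m) (Or.inr hc)]
      have := hF2 _ hc
      linarith
    · have hn : s + m = x.length := by omega
      have := hF2 (x.length + 1) (by omega)
      rw [rank_succ, rank_succ, bit_of_length_lt (x := x) (Nat.lt_succ_self _),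
        bit_of_length_lt (x := z) (i := x.length + 1) (by omega)] at this
      rw [hn] at hi ⊢
      linarith
  have beyond : ∀ i, m + 1 ≤ i →
      (rank ((x.drop s).take L) i : ℤ) - rank ((z.drop s).take L) i = 0 := by
    intro i hi
    induction i, hi using Nat.le_induction with
    | base => exact last
    | succ i hi ih =>
      rw [rank_succ, rank_succ, tu i (by omega), tu (i + 1) (by omega), tv i (by omega),
        tv (i + 1) (by omega)]
      linarith
  rcases Nat.eq_zero_or_pos i with rfl | hi
  · rw [add_zero, h0]; simp [rank]
  · rcases le_or_gt i m with h | h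
    · exact inside i hi h
    · rw [beyond i h, hF2 (s + i) (by omega)]

theorem NegPosNeg.shift {F : ℕ → ℤ} (h : NegPosNeg F) (s : ℕ) : NegPosNeg fun i => F (s + i) := by
  obtain ⟨i₁, i₂, h1, h2, h3⟩ := h
  exact ⟨i₁ - s, i₂ - s, fun i hi => h1 _ (by omega), fun i hi hi' => h2 _ (by omega) (by omega),
    fun i hi hi' => h3 _ (by omega) (by omega)⟩

theorem list_eq_of_rank {x z : List Bool} (hl : x.length = z.length)
    (h : ∀ i, (rank x i : ℤ) - rank z i = 0) : x = z := by
  refine list_eq_of_bit hl fun i _ => ?_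
  induction i with
  | zero => rfl
  | succ i ih =>
    have ih := ih (by omega)
    have h1 := h i
    have h2 := h (i + 1)
    rw [rank_succ, rank_succ, ih] at h2
    have h3 : wRun (bit z i) (bit x (i + 1)) = wRun (bit z i) (bit z (i + 1)) := by linarith
    revert h3
    generalize bit z i = a; generalize bit x (i + 1) = b; generalize bit z (i + 1) = c
    clear * -; revert a b c; decide

/-- Close strings are equal as soon as `f₁ʳ` and the numbers of runs are equal and `f₂ʳ` and `f₃ʳ`
agree on a block that contains the window with a margin. -/
theorem eq_of_closeStrings {x z : List Bool} {A B s L : ℕ} (hl : x.length = z.length)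
    (hA : 1 ≤ A) (hout : ∀ i, i < A ∨ B < i → bit x i = bit z i) (hB : B ≤ x.length)
    (hpat : NegPosNeg fun i => (rank x i : ℤ) - rank z i)
    (hr : numRuns x = numRuns z) (h1r : f1r x = f1r z)
    (hs : s + 2 ≤ A ∨ s = 0) (hsx : s < x.length)
    (hL : B + 1 ≤ s + L ∨ x.length ≤ s + L) (hL0 : 1 ≤ L)
    (h2 : f2r ((x.drop s).take L) = f2r ((z.drop s).take L))
    (h3 : f3r ((x.drop s).take L) = f3r ((z.drop s).take L)) : x = z := by
  have hblock := rank_block_sub hl hA hout hB hr hs hsx hL hL0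
  have lu : ((x.drop s).take L).length = min L (x.length - s) := by simp
  have lv : ((z.drop s).take L).length = min L (x.length - s) := by simp [hl]
  have hF1 : ∀ i, i < A → (rank x i : ℤ) - rank z i = 0 :=
    fun i hi => rank_eq_of_lt (fun i hi => hout i (Or.inl hi)) hi
  have hF2 : ∀ i, B < i → (rank x i : ℤ) - rank z i = 0 :=
    fun i hi => rank_eq_of_gt hl (fun i hi => hout i (Or.inr hi)) hB hr hi
  set u := (x.drop s).take L with hu
  set v := (z.drop s).take L with hv
  obtain ⟨m, hm⟩ : ∃ m, m = min L (x.length - s) := ⟨_, rfl⟩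
  rw [← hm] at lu lv
  have h1 : ∑ i ∈ Finset.Icc 1 (m + 1), (rank u i : ℤ) = ∑ i ∈ Finset.Icc 1 (m + 1), (rank v i : ℤ)
      := by
    rw [← sub_eq_zero, ← Finset.sum_sub_distrib]
    simp only [hblock]
    have e1 : ∑ i ∈ Finset.Icc 1 (m + 1), ((rank x (s + i) : ℤ) - rank z (s + i)) =
        ∑ i ∈ Finset.Ico (1 + s) (m + 2 + s), ((rank x i : ℤ) - rank z i) := by
      rw [← Finset.sum_Ico_add]; rfl
    have e2 := cast_f1r_sub hl
    rw [h1r, sub_self] at e2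
    simp only [← cast_rank] at e2
    rw [e1, e2]
    refine Finset.sum_subset (fun i hi => ?_) fun i hi hi' => ?_
    · simp only [Finset.mem_Ico, Finset.mem_range] at hi ⊢
      omega
    · simp only [Finset.mem_Ico, Finset.mem_range] at hi hi'
      by_cases h : i < A
      · exact hF1 i h
      · exact hF2 i (by omega)
  simp only [f2r, lu, lv] at h2
  simp only [f3r, lu, lv] at h3
  have key := eq_of_moments (rank_mono u) (rank_mono v) (I := Finset.Icc 1 (m + 1)) h1
    (by exact_mod_cast h2) (by exact_mod_cast h3)
    (by simp only [hblock]; exact hpat.shift s)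
  refine list_eq_of_rank hl fun i => ?_
  by_cases h : i < A
  · exact hF1 i h
  by_cases h' : B < i
  · exact hF2 i h'
  have hi : s + (i - s) = i := by omega
  have e := hblock (i - s)
  rw [hi, key (i - s) (Finset.mem_Icc.2 (by omega)), sub_self] at e
  exact e.symm

/-! ### Recovering exact values from residues -/

theorem testBit_eq_of_lowBits_eq {w a b : ℕ} (h : lowBits w a = lowBits w b) {i : ℕ} (hi : i < w) :
    a.testBit i = b.testBit i := by
  rw [lowBits, lowBits] at h
  exact (List.map_inj_left.1 h) i (List.mem_range.2 hi)

theorem mod_eq_of_testBit_eq {w a b : ℕ} (h : ∀ i < w, a.testBit i = b.testBit i) :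
    a % 2 ^ w = b % 2 ^ w := by
  refine Nat.eq_of_testBit_eq fun i => ?_
  rw [Nat.testBit_mod_two_pow, Nat.testBit_mod_two_pow]
  by_cases hi : i < w
  · rw [h i hi]
  · simp [hi]

theorem mod_eq_of_lowBits_eq {w a b : ℕ} (h : lowBits w a = lowBits w b) :
    a % 2 ^ w = b % 2 ^ w := mod_eq_of_testBit_eq fun _ hi => testBit_eq_of_lowBits_eq h hi

theorem xorSketch_congr {F : List Bool → ℕ} {g g' : ℕ → List Bool} {ks : List ℕ}
    (h : ∀ k ∈ ks, g k = g' k) : xorSketch F (ks.map g) = xorSketch F (ks.map g') := by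
  rw [List.map_congr_left h]

/-- If two divisions differ in one block only, the exclusive-or of the blockwise sketches is that of
the sketches of this block. -/
theorem xorSketch_xor {F : List Bool → ℕ} {g g' : ℕ → List Bool} {k₀ : ℕ}
    (h : ∀ k, k ≠ k₀ → g k = g' k) {ks : List ℕ} (hn : ks.Nodup) (hk : k₀ ∈ ks) :
    xorSketch F (ks.map g) ^^^ xorSketch F (ks.map g') = F (g k₀) ^^^ F (g' k₀) := by
  induction ks with
  | nil => simp at hk
  | cons k ks ih =>
    have e : ∀ f : ℕ → List Bool, xorSketch F ((k :: ks).map f) =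
        F (f k) ^^^ xorSketch F (ks.map f) := fun _ => rfl
    rw [e, e]
    rw [List.nodup_cons] at hn
    by_cases hkk : k = k₀
    · subst hkk
      rw [xorSketch_congr fun j hj => h j (by rintro rfl; exact hn.1 hj)]
      rw [Nat.xor_assoc, Nat.xor_left_comm _ (F (g' k)), Nat.xor_self, Nat.xor_zero]
    · have := ih hn.2 ((List.mem_cons.1 hk).resolve_left (Ne.symm hkk))
      rw [h k hkk, Nat.xor_assoc, Nat.xor_left_comm _ (F (g' k)), ← Nat.xor_assoc, Nat.xor_self,
        Nat.zero_xor, this]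

/-- Low bits of an exclusive-or determine the residues of the parts in which two strings differ. -/
theorem mod_eq_of_lowBits_xor_eq {w : ℕ} {a b u v : ℕ} (h : lowBits w a = lowBits w b)
    (huv : a ^^^ b = u ^^^ v) : u % 2 ^ w = v % 2 ^ w := by
  refine mod_eq_of_testBit_eq fun i hi => ?_
  have h1 := testBit_eq_of_lowBits_eq h hi
  have h2 : (a ^^^ b).testBit i = (u ^^^ v).testBit i := by rw [huv]
  rw [Nat.testBit_xor, Nat.testBit_xor, h1, Bool.xor_self] at h2
  revert h2
  cases u.testBit i <;> cases v.testBit i <;> simp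

theorem eq_of_mod_eq_of_abs_lt {a b M : ℕ} (h : a % M = b % M) (hlt : |(a : ℤ) - b| < M) :
    a = b := by
  have h1 : (M : ℤ) ∣ (a : ℤ) - b := (Nat.modEq_iff_dvd.1 (Nat.ModEq.symm h))
  have := Int.eq_zero_of_abs_lt_dvd h1 hlt
  omega

theorem abs_choose_sub_le {r s R : ℕ} (k : ℕ) (hr : r ≤ R) (hs : s ≤ R) :
    |((r.choose (k + 1) : ℕ) : ℤ) - (s.choose (k + 1) : ℕ)| ≤ |(r : ℤ) - s| * (R : ℤ) ^ k := by
  wlog h : s ≤ r generalizing r s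
  · rw [abs_sub_comm, abs_sub_comm (r : ℤ)]
    exact this hs hr (by omega)
  have key : ∀ r, s ≤ r → r ≤ R → ((r.choose (k + 1) : ℕ) : ℤ) - (s.choose (k + 1) : ℕ) ≤
      ((r : ℤ) - s) * (R : ℤ) ^ k := by
    intro r h
    induction r, h using Nat.le_induction with
    | base => simp
    | succ r h ih =>
      intro hr
      have h1 := ih (by omega)
      have h2 : ((r.choose k : ℕ) : ℤ) ≤ (R : ℤ) ^ k := by
        exact_mod_cast (Nat.choose_le_pow r k).trans (Nat.pow_le_pow_left (by omega) k)
      rw [Nat.choose_succ_succ']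
      push_cast
      linarith
  rw [abs_of_nonneg (by have := Nat.choose_le_choose (k + 1) h; omega),
    abs_of_nonneg (by omega)]
  exact key r h hr

/-- The effect of two deletions and two insertions on pair statistics of prefixes. -/
theorem abs_prefixSum_sub_le {w : Bool → Bool → ℤ} (h0 : ∀ a b, 0 ≤ w a b)
    (h1 : ∀ a b, w a b ≤ 1) {x y z : List Bool} (hl : x.length = z.length) (hyx : y.Sublist x)
    (hyz : y.Sublist z) (hy : y.length + 2 = x.length) (i : ℕ) :
    |prefixSum w (bit x) i - prefixSum w (bit z) i| ≤ 8 := by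
  obtain ⟨p, P, -, -, hx⟩ := exists_del_del hyx hy
  obtain ⟨q, Q, -, -, hz⟩ := exists_del_del hyz (by omega)
  have e1 := abs_le.1 (abs_prefixSum_del_sub_le h0 h1 (bit x) p i)
  have e2 := abs_le.1 (abs_prefixSum_del_sub_le h0 h1 (del p (bit x)) P i)
  have e3 := abs_le.1 (abs_prefixSum_del_sub_le h0 h1 (bit z) q i)
  have e4 := abs_le.1 (abs_prefixSum_del_sub_le h0 h1 (del q (bit z)) Q i)
  rw [← hx] at e2
  rw [← hz] at e4
  rw [abs_le]
  constructor <;> linarith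

/-- The bounds that turn residues of the global statistics into equalities. -/
theorem abs_global_sub_le {x y z : List Bool} (hl : x.length = z.length) (hyx : y.Sublist x)
    (hyz : y.Sublist z) (hy : y.length + 2 = x.length) :
    |(f1 x : ℤ) - f1 z| ≤ 32 * x.length ∧ |(f2 x : ℤ) - f2 z| ≤ 64 * x.length ^ 2 ∧
    |(f1r x : ℤ) - f1r z| ≤ 32 * x.length ∧ |(numOnes x : ℤ) - numOnes z| ≤ 8 ∧
    |(numRuns x : ℤ) - numRuns z| ≤ 8 := by
  have hD := abs_prefixSum_sub_le wOne_nonneg wOne_le_one hl hyx hyz hy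
  have hR := abs_prefixSum_sub_le wRun_nonneg wRun_le_one hl hyx hyz hy
  have hn : (2 : ℤ) ≤ x.length := by omega
  have s1 := sum_prefixSum_wOne (bit x) (bit z) (x.length + 1)
  have s2 := sum_mul_prefixSum_wOne (bit x) (bit z) (x.length + 1)
  rw [← cast_f1_sub hl] at s1
  rw [← cast_f2_sub hl] at s2
  have b1 : |∑ i ∈ Finset.range (x.length + 1 + 1),
      (prefixSum wOne (bit x) i - prefixSum wOne (bit z) i)| ≤ (x.length + 2) * 8 := by
    refine (Finset.abs_sum_le_sum_abs _ _).trans ((Finset.sum_le_card_nsmul _ _ 8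
      fun i _ => hD i).trans ?_)
    simp
  have b2 : |∑ i ∈ Finset.range (x.length + 1 + 1),
      (i : ℤ) * (prefixSum wOne (bit x) i - prefixSum wOne (bit z) i)| ≤
      (x.length + 2) * ((x.length + 2) * 8) := by
    refine (Finset.abs_sum_le_sum_abs _ _).trans ((Finset.sum_le_card_nsmul _ _
      ((x.length + 2) * 8 : ℤ) fun i hi => ?_).trans ?_)
    · rw [abs_mul, Nat.abs_cast]
      have := Finset.mem_range.1 hi
      exact mul_le_mul (by omega) (hD i) (abs_nonneg _) (by positivity)
    · simp; linarith
  have b3 := hD (x.length + 1)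
  have b4 : |(f1r x : ℤ) - f1r z| ≤ (x.length + 2) * 8 := by
    rw [cast_f1r_sub hl]
    refine (Finset.abs_sum_le_sum_abs _ _).trans ((Finset.sum_le_card_nsmul _ _ 8
      fun i _ => hR i).trans ?_)
    simp
  refine ⟨?_, ?_, ?_, ?_, ?_⟩
  · rw [abs_le] at *
    push_cast at s1
    constructor <;> nlinarith
  · have hc : ((x.length + 1 + 1).choose 2 : ℤ) ≤ (x.length + 2) ^ 2 := by
      exact_mod_cast Nat.choose_le_pow (x.length + 2) 2
    have hc0 : (0 : ℤ) ≤ ((x.length + 1 + 1).choose 2 : ℤ) := by positivity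
    have b5 : |((x.length + 1 + 1).choose 2 : ℤ) * (prefixSum wOne (bit x) (x.length + 1) -
        prefixSum wOne (bit z) (x.length + 1))| ≤ (x.length + 2) ^ 2 * 8 := by
      rw [abs_mul, abs_of_nonneg hc0]
      exact mul_le_mul hc b3 (abs_nonneg _) (by positivity)
    rw [← s2] at b5
    rw [abs_le] at *
    constructor <;> nlinarith
  · exact b4.trans (by linarith)
  · rw [cast_numOnes, cast_numOnes, ← hl]; exact hD _
  · have := hR (x.length + 1)
    rw [← cast_rank, ← cast_rank] at this
    simp only [numRuns, ← hl]
    push_cast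
    simpa using this

/-- Moments of ranks that differ by bounded amounts. -/
theorem abs_sum_choose_sub_le {x z : List Bool} {m k : ℕ}
    (h : ∀ i, |(rank x i : ℤ) - rank z i| ≤ 8) :
    |∑ i ∈ Finset.Icc 1 (m + 1), (((rank x i).choose (k + 1) : ℕ) : ℤ) -
      ∑ i ∈ Finset.Icc 1 (m + 1), (((rank z i).choose (k + 1) : ℕ) : ℤ)| ≤
    8 * (m + 1) ^ (k + 1) := by
  rw [← Finset.sum_sub_distrib]
  refine (Finset.abs_sum_le_sum_abs _ _).trans ((Finset.sum_le_card_nsmul _ _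
    (8 * ((m + 1 : ℕ) : ℤ) ^ k) fun i hi => ?_).trans ?_)
  · have := (Finset.mem_Icc.1 hi).2
    exact (abs_choose_sub_le k ((rank_le x i).trans this) ((rank_le z i).trans this)).trans
      (mul_le_mul_of_nonneg_right (h i) (by positivity))
  · simp only [Nat.card_Icc, nsmul_eq_mul]
    push_cast
    apply le_of_eq
    ring

/-! ### The local part of the sketch -/

theorem drop_take_congr {x z : List Bool} {s L : ℕ} (hl : x.length = z.length)
    (h : ∀ i, s < i → i ≤ s + L → bit x i = bit z i) :
    (x.drop s).take L = (z.drop s).take L := by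
  refine List.ext_getElem (by simp [hl]) fun i h1 h2 => ?_
  have h3 := h (s + (i + 1)) (by omega) (by simp at h1; omega)
  rw [← bit_block x s L (by omega) (by omega), ← bit_block z s L (by omega) (by omega),
    bit_succ, bit_succ, List.getD_eq_getElem _ _ h1, List.getD_eq_getElem _ _ h2] at h3
  exact h3

/-- If all differences of two strings lie in the block of number `k`, only this block contributes to
the difference of the exclusive-ors. -/
theorem xorSketch_blocks_xor (F : List Bool → ℕ) {x z : List Bool} {t L k A B : ℕ}
    (hl : x.length = z.length) (hout : ∀ i, i < A ∨ B < i → bit x i = bit z i)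
    (hB : B ≤ x.length) (hA : t + k * L < A) (hL : B ≤ t + k * L + L ∨ x.length ≤ t + k * L + L)
    (hkx : t + k * L < x.length) (hL0 : 0 < L) :
    xorSketch F (blocks L (x.drop t)) ^^^ xorSketch F (blocks L (z.drop t)) =
      F ((x.drop (t + k * L)).take L) ^^^ F ((z.drop (t + k * L)).take L) := by
  simp only [blocks, List.length_drop, ← hl]
  rw [xorSketch_xor (k₀ := k) ?_ List.nodup_range ?_]
  · simp only [List.drop_drop]
  · intro j hj
    simp only [List.drop_drop]
    refine drop_take_congr hl fun i hi hi' => hout i ?_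
    rcases lt_or_gt_of_ne hj with h | h
    · left
      have : (j + 1) * L ≤ k * L := Nat.mul_le_mul_right L h
      rw [add_mul, one_mul] at this
      omega
    · right
      have : (k + 1) * L ≤ j * L := Nat.mul_le_mul_right L h
      rw [add_mul, one_mul] at this
      omega
  · rw [List.mem_range, Nat.lt_iff_add_one_le, Nat.le_div_iff_mul_le hL0, add_mul, one_mul]
    omega

/-- A window of a regular string without two equal adjacent bits of one kind is short. -/
theorem IsRegular.window_lt {d : ℝ} {x : List Bool} (hx : IsRegular d x) {A B : ℕ} {b : Bool}
    (hA : 1 ≤ A) (hAB : A ≤ B) (hB : B ≤ x.length)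
    (h : ∀ j, A ≤ j → j < B → ¬ (bit x j = b ∧ bit x (j + 1) = b)) :
    ((B + 1 - A : ℕ) : ℝ) < d * Real.logb 2 x.length := by
  by_contra hlt
  rw [not_lt] at hlt
  have hw : ((x.drop (A - 1)).take (B + 1 - A)).length = B + 1 - A := by
    simp; omega
  have := hx ((x.drop (A - 1)).take (B + 1 - A))
    ((List.take_prefix _ _).isInfix.trans (List.drop_suffix _ _).isInfix) (by rw [hw]; exact hlt)
  have hb : [b, b] <:+: (x.drop (A - 1)).take (B + 1 - A) := by
    cases b
    · exact this.1
    · exact this.2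
  obtain ⟨s, t, hst⟩ := hb
  have hlen : s.length + 2 + t.length = B + 1 - A := by rw [← hw, ← hst]; simp; ring
  refine h (A + s.length) (by omega) (by omega) ⟨?_, ?_⟩
  · have e := bit_block x (A - 1) (B + 1 - A) (i := s.length + 1) (by omega) (by omega)
    rw [show A - 1 + (s.length + 1) = A + s.length by omega, ← hst, bit_succ] at e
    rw [← e, List.getD_eq_getElem?_getD]
    simp
  · have e := bit_block x (A - 1) (B + 1 - A) (i := s.length + 2) (by omega) (by omega)
    rw [show A - 1 + (s.length + 2) = A + s.length + 1 by omega, ← hst, bit_succ] at e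
    rw [← e, List.getD_eq_getElem?_getD]
    simp

/-- The exact values behind the local sketches agree on the block that contains the window. -/
theorem eq_of_closeStrings_of_local {x z : List Bool} {A B h w₂ w₃ : ℕ}
    (hl : x.length = z.length)
    (hA : 1 ≤ A) (hAB : A ≤ B) (hout : ∀ i, i < A ∨ B < i → bit x i = bit z i)
    (hB : B ≤ x.length)
    (hpat : NegPosNeg fun i => (rank x i : ℤ) - rank z i)
    (h1r : f1r x = f1r z) (hr : numRuns x = numRuns z) (hlen : B + 1 - A < h)
    (hrank : ∀ i, |(rank x i : ℤ) - rank z i| ≤ 8)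
    (hw₂ : 8 * (2 * h + 1) ^ 2 < 2 ^ w₂) (hw₃ : 8 * (2 * h + 1) ^ 3 < 2 ^ w₃)
    (e1 : lowBits w₂ (xorSketch f2r (blocks (2 * h) x)) =
      lowBits w₂ (xorSketch f2r (blocks (2 * h) z)))
    (e2 : lowBits w₃ (xorSketch f3r (blocks (2 * h) x)) =
      lowBits w₃ (xorSketch f3r (blocks (2 * h) z)))
    (e3 : lowBits w₂ (xorSketch f2r (shiftedBlocks h x)) =
      lowBits w₂ (xorSketch f2r (shiftedBlocks h z)))
    (e4 : lowBits w₃ (xorSketch f3r (shiftedBlocks h x)) =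
      lowBits w₃ (xorSketch f3r (shiftedBlocks h z))) : x = z := by
  -- the block starts at the last multiple of `h` that leaves a margin before the window
  obtain ⟨j, hj⟩ : ∃ j, j = (A - 2) / h := ⟨_, rfl⟩
  have hj1 : j * h ≤ A - 2 := hj ▸ Nat.div_mul_le_self _ _
  have hj2 : A - 2 < j * h + h := by
    have := Nat.lt_div_mul_add (a := A - 2) (b := h) (by omega)
    rwa [← hj] at this
  obtain ⟨s, hs⟩ : ∃ s, s = j * h := ⟨_, rfl⟩
  rw [← hs] at hj1 hj2
  have hsA : s + 2 ≤ A ∨ s = 0 := by omega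
  have hsL : B + 1 ≤ s + 2 * h := by omega
  have hblock : ∀ i, |(rank ((x.drop s).take (2 * h)) i : ℤ) -
      rank ((z.drop s).take (2 * h)) i| ≤ 8 := fun i => by
    rw [rank_block_sub hl hA hout hB hr hsA (by omega) (Or.inl hsL) (by omega)]
    exact hrank _
  have lu : ((x.drop s).take (2 * h)).length = min (2 * h) (x.length - s) := by simp
  have lv : ((z.drop s).take (2 * h)).length = min (2 * h) (x.length - s) := by simp [hl]
  have hm : ((min (2 * h) (x.length - s) : ℕ) : ℤ) + 1 ≤ 2 * h + 1 := by
    have := min_le_left (2 * h) (x.length - s)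
    omega
  have main : ∀ {F : List Bool → ℕ} {w : ℕ},
      lowBits w (xorSketch F (blocks (2 * h) x)) = lowBits w (xorSketch F (blocks (2 * h) z)) →
      lowBits w (xorSketch F (shiftedBlocks h x)) = lowBits w (xorSketch F (shiftedBlocks h z)) →
      F ((x.drop s).take (2 * h)) % 2 ^ w = F ((z.drop s).take (2 * h)) % 2 ^ w := by
    intro F w g1 g2
    rcases Nat.even_or_odd' j with ⟨k, hk | hk⟩
    · -- even multiples start blocks of the first division
      have hsk : s = 0 + k * (2 * h) := by rw [hs, hk]; ring
      have := xorSketch_blocks_xor F (t := 0) (L := 2 * h) (k := k) hl hout hB (by omega)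
        (by omega) (by omega) (by omega)
      rw [← hsk] at this
      exact mod_eq_of_lowBits_xor_eq g1 this
    · have hsk : s = h + k * (2 * h) := by rw [hs, hk]; ring
      have := xorSketch_blocks_xor F (t := h) (L := 2 * h) (k := k) hl hout hB (by omega)
        (by omega) (by omega) (by omega)
      rw [← hsk] at this
      refine mod_eq_of_lowBits_xor_eq g2 (Eq.trans ?_ this)
      have e : ∀ u, xorSketch F (shiftedBlocks h u) =
          F (u.take h) ^^^ xorSketch F (blocks (2 * h) (u.drop h)) := fun _ => rfl
      have hfirst : x.take h = z.take h := by
        have := drop_take_congr (s := 0) (L := h) hl fun i _ hi => hout i (Or.inl ?_)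
        · simpa using this
        · have : h ≤ s := by omega
          omega
      rw [e, e, hfirst, Nat.xor_assoc, Nat.xor_left_comm _ (F (z.take h)), ← Nat.xor_assoc,
        Nat.xor_self, Nat.zero_xor]
  refine eq_of_closeStrings hl hA hout hB hpat hr h1r hsA (by omega) (Or.inl hsL) (by omega)
    (eq_of_mod_eq_of_abs_lt (main e1 e3) ?_) (eq_of_mod_eq_of_abs_lt (main e2 e4) ?_)
  · have := abs_sum_choose_sub_le (m := min (2 * h) (x.length - s)) (k := 1) hblock
    simp only [f2r, lu, lv]
    push_cast
    push_cast at this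
    have hw : (8 : ℤ) * (2 * h + 1) ^ 2 < 2 ^ w₂ := by exact_mod_cast hw₂
    refine this.trans_lt (lt_of_le_of_lt ?_ hw)
    push_cast at hm
    gcongr
  · have := abs_sum_choose_sub_le (m := min (2 * h) (x.length - s)) (k := 2) hblock
    simp only [f3r, lu, lv]
    push_cast
    push_cast at this
    have hw : (8 : ℤ) * (2 * h + 1) ^ 3 < 2 ^ w₃ := by exact_mod_cast hw₃
    refine this.trans_lt (lt_of_le_of_lt ?_ hw)
    push_cast at hm
    gcongr

theorem length_lowBits (w m : ℕ) : (lowBits w m).length = w := by simp [lowBits]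

theorem mul_logb_le_halfBlock {d : ℝ} {n : ℕ} (hn : 2 ≤ n) :
    d * Real.logb 2 n ≤ halfBlock ⌈d⌉₊ n := by
  have hn0 : (0 : ℝ) < n := by positivity
  have hlog : 0 ≤ Real.logb 2 n := Real.logb_nonneg (by norm_num) (by exact_mod_cast (by omega))
  refine (mul_le_mul_of_nonneg_right (Nat.le_ceil d) hlog).trans ?_
  rw [← Real.logb_pow, Real.logb_le_iff_le_rpow (by norm_num) (by positivity), Real.rpow_natCast]
  exact_mod_cast Nat.le_pow_clog (by norm_num) (n ^ ⌈d⌉₊)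

theorem halfBlock_le (D n : ℕ) : halfBlock D n ≤ D * Nat.clog 2 n := by
  refine Nat.clog_le_of_le_pow ?_
  rw [mul_comm, pow_mul]
  exact Nat.pow_le_pow_left (Nat.le_pow_clog (by norm_num) n) D

/-- Regular strings are determined by the sketch and any subsequence that misses two bits. -/
theorem eq_of_sketch_eq {d : ℝ} (hd : 0 < d) {c : ℕ} (hc : 512 * ⌈d⌉₊ ^ 3 < 2 ^ c)
    {x y z : List Bool} (hx : IsRegular d x) (hyx : y.Sublist x) (hyz : y.Sublist z)
    (hl : x.length = z.length) (hy : y.length + 2 = x.length)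
    (hs : sketch ⌈d⌉₊ c x = sketch ⌈d⌉₊ c z) : x = z := by
  have hn : 2 ≤ x.length := by omega
  have hD : 1 ≤ ⌈d⌉₊ := Nat.ceil_pos.2 hd
  have hL := mul_logb_le_halfBlock (d := d) hn
  have hhD := halfBlock_le ⌈d⌉₊ x.length
  obtain ⟨D, hDdef⟩ : ∃ D, D = ⌈d⌉₊ := ⟨_, rfl⟩
  simp only [← hDdef] at *
  clear hDdef
  simp only [sketch, ← hl] at hs
  obtain ⟨a, ha⟩ : ∃ a, a = Nat.clog 2 x.length := ⟨_, rfl⟩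
  obtain ⟨b, hb⟩ : ∃ b, b = Nat.clog 2 a := ⟨_, rfl⟩
  obtain ⟨h, hh⟩ : ∃ h, h = halfBlock D x.length := ⟨_, rfl⟩
  rw [← ha, ← hb, ← hh] at hs
  rw [← hh] at hL
  rw [← hh, ← ha] at hhD
  have hna : x.length ≤ 2 ^ a := ha ▸ Nat.le_pow_clog (by norm_num) _
  have hab : a ≤ 2 ^ b := hb ▸ Nat.le_pow_clog (by norm_num) _
  have hlen : ∀ w u v, (lowBits w u).length = (lowBits w v).length := fun w u v => by
    rw [length_lowBits, length_lowBits]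
  obtain ⟨hs, e9⟩ := List.append_inj' hs (hlen _ _ _)
  obtain ⟨hs, e8⟩ := List.append_inj' hs (hlen _ _ _)
  obtain ⟨hs, e7⟩ := List.append_inj' hs (hlen _ _ _)
  obtain ⟨hs, e6⟩ := List.append_inj' hs (hlen _ _ _)
  obtain ⟨hs, e5⟩ := List.append_inj' hs (hlen _ _ _)
  obtain ⟨hs, e4⟩ := List.append_inj' hs (hlen _ _ _)
  obtain ⟨hs, e3⟩ := List.append_inj' hs (hlen _ _ _)
  obtain ⟨e1, e2⟩ := List.append_inj' hs (hlen _ _ _)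
  obtain ⟨b1, b2, b3, b4, b5⟩ := abs_global_sub_le hl hyx hyz hy
  have hc0 : (64 : ℤ) < 2 ^ c := by
    have : 1 ≤ D ^ 3 := Nat.one_le_pow _ _ hD
    exact_mod_cast (by omega : 64 < 2 ^ c)
  have hnz : (x.length : ℤ) ≤ 2 ^ a := by exact_mod_cast hna
  have hn0 : (2 : ℤ) ≤ x.length := by exact_mod_cast hn
  have hlin : 32 * (x.length : ℤ) < ((2 ^ (a + c) : ℕ) : ℤ) := by
    rw [pow_add]; push_cast; nlinarith
  have q1 : f1 x = f1 z := eq_of_mod_eq_of_abs_lt (mod_eq_of_lowBits_eq e1) (b1.trans_lt hlin)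
  have q3 : f1r x = f1r z := eq_of_mod_eq_of_abs_lt (mod_eq_of_lowBits_eq e3) (b3.trans_lt hlin)
  have q2 : f2 x = f2 z := by
    refine eq_of_mod_eq_of_abs_lt (mod_eq_of_lowBits_eq e2) (b2.trans_lt ?_)
    have h2 : (x.length : ℤ) ^ 2 ≤ (2 ^ a) ^ 2 := by gcongr
    have h0 : (0 : ℤ) < (x.length : ℤ) ^ 2 := by positivity
    have e : ((2 ^ (2 * a + c) : ℕ) : ℤ) = (2 ^ a) ^ 2 * 2 ^ c := by push_cast; ring
    rw [e]
    nlinarith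
  have q8 : numOnes x = numOnes z := eq_of_mod_eq_of_abs_lt (mod_eq_of_lowBits_eq e8)
    (b4.trans_lt (by push_cast; linarith))
  have q9 : numRuns x = numRuns z := eq_of_mod_eq_of_abs_lt (mod_eq_of_lowBits_eq e9)
    (b5.trans_lt (by push_cast; linarith))
  -- the widths of the local sketches suffice for strings of length `2 h`
  have hh1 : 2 * h + 1 ≤ 4 * D * 2 ^ b := by
    have h1 : h ≤ D * 2 ^ b := hhD.trans (Nat.mul_le_mul_left D hab)
    have h2 : 1 ≤ D * 2 ^ b := Nat.mul_pos hD (by positivity)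
    linarith
  have hw₂ : 8 * (2 * h + 1) ^ 2 < 2 ^ (2 * b + c) := by
    have e : 8 * (4 * D * 2 ^ b) ^ 2 = 128 * D ^ 2 * 2 ^ (2 * b) := by ring
    have hDD : D ^ 2 ≤ D ^ 3 := Nat.pow_le_pow_right hD (by norm_num)
    calc 8 * (2 * h + 1) ^ 2 ≤ 8 * (4 * D * 2 ^ b) ^ 2 := by gcongr
      _ = 128 * D ^ 2 * 2 ^ (2 * b) := e
      _ < 2 ^ c * 2 ^ (2 * b) := by gcongr; omega
      _ = 2 ^ (2 * b + c) := by ring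
  have hw₃ : 8 * (2 * h + 1) ^ 3 < 2 ^ (3 * b + c) := by
    have e : 8 * (4 * D * 2 ^ b) ^ 3 = 512 * D ^ 3 * 2 ^ (3 * b) := by ring
    calc 8 * (2 * h + 1) ^ 3 ≤ 8 * (4 * D * 2 ^ b) ^ 3 := by gcongr
      _ = 512 * D ^ 3 * 2 ^ (3 * b) := e
      _ < 2 ^ c * 2 ^ (3 * b) := by gcongr
      _ = 2 ^ (3 * b + c) := by ring
  have hR := abs_prefixSum_sub_le wRun_nonneg wRun_le_one hl hyx hyz hy
  simp only [← cast_rank] at hR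
  rcases eq_or_closeStrings hl hyx hyz hy q1 q2 q3 q8 q9 with
    he | ⟨A, B, hA, hAB, hB, hout, ⟨s, hs⟩, hpat⟩ | ⟨A, B, hA, hAB, hB, hout, ⟨s, hs⟩, hpat⟩
  · exact he
  · have := (hx.window_lt hA hAB hB fun j h1 h2 => (hs j h1 h2).1).trans_le hL
    exact eq_of_closeStrings_of_local hl hA hAB hout hB hpat q3 q9 (by exact_mod_cast this) hR hw₂
      hw₃ e4 e5 e6 e7
  · have := (hx.window_lt hA hAB (by omega) fun j h1 h2 => (hs j h1 h2).2).trans_le hL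
    exact (eq_of_closeStrings_of_local hl.symm hA hAB hout hB hpat q3.symm q9.symm
      (by exact_mod_cast this) (fun i => by rw [abs_sub_comm]; exact hR i) hw₂
      hw₃ e4.symm e5.symm e6.symm e7.symm).symm

/-! ### The length of the sketch -/

theorem length_sketch (D c : ℕ) (x : List Bool) : (sketch D c x).length =
    4 * Nat.clog 2 x.length + 10 * Nat.clog 2 (Nat.clog 2 x.length) + 9 * c := by
  simp only [sketch, List.length_append, length_lowBits]
  ring

theorem clog_le_logb_add_one {n : ℕ} (hn : 1 ≤ n) : (Nat.clog 2 n : ℝ) ≤ Real.logb 2 n + 1 := by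
  have h := Real.natCeil_logb_natCast 2 n
  have h0 : 0 ≤ Real.logb 2 n := Real.logb_nonneg (by norm_num) (by exact_mod_cast hn)
  have := (Nat.ceil_lt_add_one h0).le
  rw [← h]
  exact_mod_cast this

theorem length_sketch_le {n : ℕ} (hn : 2 ≤ n) :
    (4 * Nat.clog 2 n + 10 * Nat.clog 2 (Nat.clog 2 n) : ℝ) ≤
      4 * Real.logb 2 n + 10 * Real.logb 2 (Real.logb 2 n) + 24 := by
  have h1 := clog_le_logb_add_one (n := n) (by omega)
  have ha : 1 ≤ Nat.clog 2 n := Nat.clog_pos (by norm_num) hn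
  have h2 := clog_le_logb_add_one ha
  have hlog : 1 ≤ Real.logb 2 n := by
    rw [Real.le_logb_iff_rpow_le (by norm_num) (by positivity)]
    simpa using (by exact_mod_cast hn : (2 : ℝ) ≤ n)
  have h3 : Real.logb 2 (Nat.clog 2 n) ≤ Real.logb 2 (Real.logb 2 n) + 1 := by
    calc Real.logb 2 (Nat.clog 2 n) ≤ Real.logb 2 (Real.logb 2 n * 2) :=
          Real.logb_le_logb_of_le (by norm_num) (by exact_mod_cast ha) (by linarith)
      _ = Real.logb 2 (Real.logb 2 n) + 1 := by
          rw [Real.logb_mul (by positivity) (by norm_num), Real.logb_self_eq_one (by norm_num)]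
  linarith

/-! ### Polynomially bounded functions -/

/-- Monotone functions with a polynomial bound. -/
def PolyBounded (b : ℕ → ℕ) : Prop := Monotone b ∧ ∃ K k, ∀ m, b m ≤ K * (m + 1) ^ k

theorem PolyBounded.const (c : ℕ) : PolyBounded fun _ => c :=
  ⟨monotone_const, c, 0, fun m => by simp⟩

theorem PolyBounded.id : PolyBounded fun m => m :=
  ⟨monotone_id, 1, 1, fun m => by simp⟩

theorem PolyBounded.add {b₁ b₂ : ℕ → ℕ} (h₁ : PolyBounded b₁) (h₂ : PolyBounded b₂) :
    PolyBounded fun m => b₁ m + b₂ m := by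
  obtain ⟨m₁, K₁, k₁, h₁⟩ := h₁
  obtain ⟨m₂, K₂, k₂, h₂⟩ := h₂
  refine ⟨m₁.add m₂, K₁ + K₂, k₁ + k₂, fun m => ?_⟩
  rw [add_mul]
  refine add_le_add ((h₁ m).trans ?_) ((h₂ m).trans ?_)
  · exact Nat.mul_le_mul_left _ (Nat.pow_le_pow_right (by omega) (by omega))
  · exact Nat.mul_le_mul_left _ (Nat.pow_le_pow_right (by omega) (by omega))

theorem PolyBounded.mul {b₁ b₂ : ℕ → ℕ} (h₁ : PolyBounded b₁) (h₂ : PolyBounded b₂) :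
    PolyBounded fun m => b₁ m * b₂ m := by
  obtain ⟨m₁, K₁, k₁, h₁⟩ := h₁
  obtain ⟨m₂, K₂, k₂, h₂⟩ := h₂
  refine ⟨fun a b h => Nat.mul_le_mul (m₁ h) (m₂ h), K₁ * K₂, k₁ + k₂, fun m => ?_⟩
  calc b₁ m * b₂ m ≤ (K₁ * (m + 1) ^ k₁) * (K₂ * (m + 1) ^ k₂) := Nat.mul_le_mul (h₁ m) (h₂ m)
    _ = K₁ * K₂ * (m + 1) ^ (k₁ + k₂) := by ring

theorem PolyBounded.comp {b₁ b₂ : ℕ → ℕ} (h₁ : PolyBounded b₁) (h₂ : PolyBounded b₂) :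
    PolyBounded fun m => b₁ (b₂ m) := by
  obtain ⟨m₁, K₁, k₁, h₁⟩ := h₁
  obtain ⟨m₂, K₂, k₂, h₂⟩ := h₂
  refine ⟨m₁.comp m₂, K₁ * (K₂ + 1) ^ k₁, k₂ * k₁, fun m => ?_⟩
  calc b₁ (b₂ m) ≤ K₁ * (b₂ m + 1) ^ k₁ := h₁ _
    _ ≤ K₁ * ((K₂ + 1) * (m + 1) ^ k₂) ^ k₁ := by
      refine Nat.mul_le_mul_left _ (Nat.pow_le_pow_left ?_ _)
      have := h₂ m
      have := Nat.one_le_pow k₂ (m + 1) (by omega)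
      linarith
    _ = K₁ * (K₂ + 1) ^ k₁ * (m + 1) ^ (k₂ * k₁) := by rw [mul_pow, ← pow_mul]; ring

/-! ### Functions built from bounded sums -/

/-- Prepend a value to an assignment of variables. -/
def scons (a : ℕ) (v : ℕ → ℕ) : ℕ → ℕ
  | 0 => a
  | i + 1 => v i

/-- The functions of a string and of natural variables that are built from the variables, constants,
the length and the bits of the string by addition, truncated subtraction and bounded sums; a
sum binds variable `0`. All values and loop lengths are polynomially bounded. -/
inductive BSum : (List Bool → (ℕ → ℕ) → ℕ) → Prop
  | var (i : ℕ) : BSum fun _ v => v i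
  | const (k : ℕ) : BSum fun _ _ => k
  | len : BSum fun x _ => x.length
  | read {f} : BSum f → BSum fun x v => (x.getD (f x v) false).toNat
  | add {f g} : BSum f → BSum g → BSum fun x v => f x v + g x v
  | sub {f g} : BSum f → BSum g → BSum fun x v => f x v - g x v
  | sum {f g} : BSum f → BSum g →
      BSum fun x v => ∑ i ∈ Finset.range (f x v), g x (scons i v)

/-- Renaming of variables. -/
theorem BSum.rename {f} (hf : BSum f) : ∀ σ : ℕ → ℕ, BSum fun x v => f x fun i => v (σ i) := by
  induction hf with
  | var i => exact fun σ => .var _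
  | const k => exact fun _ => .const k
  | len => exact fun _ => .len
  | read _ ih => exact fun σ => (ih σ).read
  | add _ _ ih₁ ih₂ => exact fun σ => (ih₁ σ).add (ih₂ σ)
  | sub _ _ ih₁ ih₂ => exact fun σ => (ih₁ σ).sub (ih₂ σ)
  | @sum f g _ _ ih₁ ih₂ =>
    intro σ
    have := (ih₁ σ).sum (ih₂ (scons 0 fun i => σ i + 1))
    have e : ∀ (v : ℕ → ℕ) (i : ℕ), (fun j => scons i v (scons 0 (fun i => σ i + 1) j)) =
        scons i fun j => v (σ j) := fun v i => by funext j; cases j <;> rfl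
    simpa only [e] using this

theorem BSum.weaken {f} (hf : BSum f) : BSum fun x v => f x fun i => v (i + 1) := hf.rename _

/-- Values are polynomially bounded. -/
theorem BSum.bounded {f} (hf : BSum f) : ∃ b, PolyBounded b ∧
    ∀ x v M, (∀ i, v i ≤ M) → f x v ≤ b (x.length + M) := by
  induction hf with
  | var i => exact ⟨_, .id, fun x v M h => (h i).trans (by omega)⟩
  | const k => exact ⟨_, .const k, fun _ _ _ _ => le_rfl⟩
  | len => exact ⟨_, .id, fun _ _ _ _ => Nat.le_add_right _ _⟩
  | read _ _ => exact ⟨_, .const 1, fun _ _ _ _ => Bool.toNat_le _⟩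
  | add _ _ ih₁ ih₂ =>
    obtain ⟨b₁, h₁, e₁⟩ := ih₁
    obtain ⟨b₂, h₂, e₂⟩ := ih₂
    exact ⟨_, h₁.add h₂, fun x v M h => add_le_add (e₁ x v M h) (e₂ x v M h)⟩
  | sub _ _ ih₁ _ =>
    obtain ⟨b₁, h₁, e₁⟩ := ih₁
    exact ⟨_, h₁, fun x v M h => (Nat.sub_le _ _).trans (e₁ x v M h)⟩
  | sum _ _ ih₁ ih₂ =>
    obtain ⟨b₁, h₁, e₁⟩ := ih₁
    obtain ⟨b₂, h₂, e₂⟩ := ih₂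
    refine ⟨_, h₁.mul (h₂.comp (PolyBounded.id.add h₁)), fun x v M h => ?_⟩
    refine (Finset.sum_le_card_nsmul _ _ _ fun i hi => e₂ x (scons i v)
      (M + b₁ (x.length + M)) fun j => ?_).trans ?_
    · have := Finset.mem_range.1 hi
      have := e₁ x v M h
      cases j with
      | zero => simp only [scons]; omega
      | succ j => exact (h j).trans (by omega)
    · rw [Finset.card_range, smul_eq_mul, ← add_assoc]
      exact Nat.mul_le_mul_right _ (e₁ x v M h)

/-! ### Compilation to programs -/

@[simp] theorem setReg_reg (s : Config) (r v : ℕ) :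
    (s.setReg r v).reg = Function.update s.reg r v := rfl
@[simp] theorem setReg_mem (s : Config) (r v : ℕ) : (s.setReg r v).mem = s.mem := rfl
@[simp] theorem setMem_reg (s : Config) (r v : ℕ) : (s.setMem r v).reg = s.reg := rfl
@[simp] theorem setMem_mem (s : Config) (r v : ℕ) :
    (s.setMem r v).mem = Function.update s.mem r v := rfl

/-- An invariant that every iteration carries on holds after a loop. -/
theorem exec_loop {P : Prog} {I : ℕ → Config → Prop} {r B : ℕ} {s : Config} (h0 : I 0 s)
    (h : ∀ k < s.reg r, ∀ t, I k t → I (k + 1) (P.exec t).1 ∧ (P.exec t).2 ≤ B) :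
    I (s.reg r) ((Prog.loop r P).exec s).1 ∧
      ((Prog.loop r P).exec s).2 ≤ 1 + s.reg r * (B + 1) := by
  have key : ∀ k ≤ s.reg r,
      I k ((fun e : Config × ℕ => ((P.exec e.1).1, e.2 + (P.exec e.1).2 + 1))^[k] (s, 1)).1 ∧
      ((fun e : Config × ℕ => ((P.exec e.1).1, e.2 + (P.exec e.1).2 + 1))^[k] (s, 1)).2 ≤
        1 + k * (B + 1) := by
    intro k
    induction k with
    | zero => exact fun _ => ⟨h0, by simp⟩
    | succ k ih =>
      intro hk
      obtain ⟨i1, i2⟩ := ih (by omega)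
      obtain ⟨j1, j2⟩ := h k (by omega) _ i1
      rw [Function.iterate_succ_apply']
      refine ⟨j1, ?_⟩
      dsimp only
      rw [add_mul, one_mul]
      omega
  exact key _ le_rfl

/-- Register `0` holds the length of the string `x`, and the memory begins with its bits. -/
def Holds (x : List Bool) (s : Config) : Prop :=
  s.reg 0 = x.length ∧ ∀ i < x.length, s.mem i = (x.getD i false).toNat

/-- `P` computes `f` into register `t`, leaving the memory and the registers below `t` alone. The
variables of `f` are read from the registers `ρ 0, ρ 1, …`. -/
def Computes (P : Prog) (b : ℕ → ℕ) (f : List Bool → (ℕ → ℕ) → ℕ) (ρ : ℕ → ℕ) (t : ℕ) : Prop :=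
  ∀ x s, Holds x s →
    (P.exec s).1.reg t = f x (fun i => s.reg (ρ i)) ∧ (∀ r < t, (P.exec s).1.reg r = s.reg r) ∧
    (P.exec s).1.mem = s.mem ∧ ∀ M, (∀ i, s.reg (ρ i) ≤ M) → (P.exec s).2 ≤ b (x.length + M)

theorem Holds.congr {x : List Bool} {s s' : Config} (h : Holds x s) (hr : s'.reg 0 = s.reg 0)
    (hm : s'.mem = s.mem) : Holds x s' := ⟨hr.trans h.1, fun i hi => by rw [hm]; exact h.2 i hi⟩

theorem BSum.compile {f} (hf : BSum f) : ∀ (ρ : ℕ → ℕ) (t : ℕ), 0 < t → (∀ i, ρ i < t) →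
    ∃ P b, PolyBounded b ∧ Computes P b f ρ t := by
  induction hf with
  | var i =>
    intro ρ t ht hρ
    refine ⟨.seq (.const t 0) (.add t t (ρ i)), _, .const 2, fun x s hs => ?_⟩
    have := (hρ i).ne
    simp only [Prog.exec, setReg_reg, setReg_mem]
    refine ⟨by simp [Function.update_of_ne this], fun r hr => ?_, trivial, fun _ _ => by simp⟩
    simp [Function.update_of_ne hr.ne]
  | const k =>
    intro ρ t ht hρ
    refine ⟨.const t k, _, .const 1, fun x s hs => ?_⟩
    simp only [Prog.exec, setReg_reg, setReg_mem]
    refine ⟨by simp, fun r hr => ?_, trivial, fun _ _ => by simp⟩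
    simp [Function.update_of_ne hr.ne]
  | len =>
    intro ρ t ht hρ
    refine ⟨.seq (.const t 0) (.add t t 0), _, .const 2, fun x s hs => ?_⟩
    simp only [Prog.exec, setReg_reg, setReg_mem]
    refine ⟨by simp [Function.update_of_ne ht.ne, hs.1], fun r hr => ?_, trivial,
      fun _ _ => by simp⟩
    simp [Function.update_of_ne hr.ne]
  | @read f _ ih =>
    intro ρ t ht hρ
    obtain ⟨P, b, hb, hP⟩ := ih ρ t ht hρ
    -- positions beyond the end of the string are not read from the memory
    refine ⟨.seq P (.seq (.sub (t + 1) 0 t) (.ifZero (t + 1) (.const t 0) (.load t t))), _,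
      hb.add (.const 3), fun x s hs => ?_⟩
    obtain ⟨e1, e2, e3, e4⟩ := hP x s hs
    have e0 : (P.exec s).1.reg 0 = x.length := (e2 0 ht).trans hs.1
    have hreg : ∀ v, Function.update (P.exec s).1.reg (t + 1) v t = (P.exec s).1.reg t :=
      fun v => Function.update_of_ne (by omega) _ _
    simp only [Prog.exec, setReg_reg, setReg_mem, Function.update_self, hreg, e0, e1, e3]
    split_ifs with h
    · refine ⟨?_, fun r hr => ?_, e3, fun M hM => ?_⟩
      · rw [List.getD_eq_default _ _ (by omega)]
        simp
      · simp only [setReg_reg]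
        rw [Function.update_of_ne hr.ne, Function.update_of_ne (by omega), e2 r hr]
      · have := e4 M hM
        dsimp only
        omega
    · refine ⟨?_, fun r hr => ?_, e3, fun M hM => ?_⟩
      · simp only [setReg_reg, Function.update_self]
        exact hs.2 _ (by omega)
      · simp only [setReg_reg]
        rw [Function.update_of_ne hr.ne, Function.update_of_ne (by omega), e2 r hr]
      · have := e4 M hM
        dsimp only
        omega
  | @add f g _ _ ih₁ ih₂ =>
    intro ρ t ht hρ
    obtain ⟨P, b, hb, hP⟩ := ih₁ ρ t ht hρ
    obtain ⟨Q, c, hc, hQ⟩ := ih₂ ρ (t + 1) (by omega) fun i => (hρ i).trans (by omega)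
    refine ⟨.seq P (.seq Q (.add t t (t + 1))), _, (hb.add hc).add (.const 1), fun x s hs => ?_⟩
    obtain ⟨e1, e2, e3, e4⟩ := hP x s hs
    obtain ⟨d1, d2, d3, d4⟩ := hQ x (P.exec s).1 (hs.congr (e2 0 ht) e3)
    simp only [e2 _ (hρ _)] at d1 d4
    simp only [Prog.exec, setReg_reg, setReg_mem]
    refine ⟨?_, fun r hr => ?_, d3.trans e3, fun M hM => ?_⟩
    · rw [Function.update_self, d1, d2 t (by omega), e1]
    · rw [Function.update_of_ne hr.ne, d2 r (by omega), e2 r hr]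
    · have := e4 M hM
      have := d4 M hM
      omega
  | @sub f g _ _ ih₁ ih₂ =>
    intro ρ t ht hρ
    obtain ⟨P, b, hb, hP⟩ := ih₁ ρ t ht hρ
    obtain ⟨Q, c, hc, hQ⟩ := ih₂ ρ (t + 1) (by omega) fun i => (hρ i).trans (by omega)
    refine ⟨.seq P (.seq Q (.sub t t (t + 1))), _, (hb.add hc).add (.const 1), fun x s hs => ?_⟩
    obtain ⟨e1, e2, e3, e4⟩ := hP x s hs
    obtain ⟨d1, d2, d3, d4⟩ := hQ x (P.exec s).1 (hs.congr (e2 0 ht) e3)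
    simp only [e2 _ (hρ _)] at d1 d4
    simp only [Prog.exec, setReg_reg, setReg_mem]
    refine ⟨?_, fun r hr => ?_, d3.trans e3, fun M hM => ?_⟩
    · rw [Function.update_self, d1, d2 t (by omega), e1]
    · rw [Function.update_of_ne hr.ne, d2 r (by omega), e2 r hr]
    · have := e4 M hM
      have := d4 M hM
      omega
  | @sum f g hf _ ih₁ ih₂ =>
    intro ρ t ht hρ
    obtain ⟨a, ha, hav⟩ := hf.bounded
    obtain ⟨P, b, hb, hP⟩ := ih₁ ρ (t + 2) (by omega) fun i => (hρ i).trans (by omega)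
    obtain ⟨Q, c, hc, hQ⟩ := ih₂ (scons (t + 1) ρ) (t + 2) (by omega) (by
      intro i
      cases i with
      | zero => simp [scons]
      | succ i => exact (hρ i).trans (by omega))
    -- register `t` accumulates the sum, register `t + 1` holds the index
    refine ⟨.seq P (.seq (.const t 0) (.seq (.const (t + 1) 0) (.loop (t + 2) (.seq Q
      (.seq (.add t t (t + 2)) (.seq (.const (t + 2) 1) (.add (t + 1) (t + 1) (t + 2)))))))), _,
      (hb.add (.const 3)).add (ha.mul ((hc.comp (PolyBounded.id.add ha)).add (.const 4))),
      fun x s hs => ?_⟩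
    obtain ⟨e1, e2, e3, e4⟩ := hP x s hs
    obtain ⟨s₁, hs₁⟩ : ∃ s₁, s₁ = ((P.exec s).1.setReg t 0).setReg (t + 1) 0 := ⟨_, rfl⟩
    have hs₁r : ∀ r < t, s₁.reg r = s.reg r := by
      intro r hr
      simp only [hs₁, setReg_reg]
      rw [Function.update_of_ne (by omega), Function.update_of_ne (by omega), e2 r (by omega)]
    have hs₁2 : s₁.reg (t + 2) = f x fun i => s.reg (ρ i) := by
      simp only [hs₁, setReg_reg]
      rw [Function.update_of_ne (by omega), Function.update_of_ne (by omega), e1]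
    have hs₁m : s₁.mem = s.mem := by simp only [hs₁, setReg_mem, e3]
    have loop := fun M (hM : ∀ i, s.reg (ρ i) ≤ M) => exec_loop (r := t + 2) (s := s₁)
      (P := .seq Q (.seq (.add t t (t + 2)) (.seq (.const (t + 2) 1)
        (.add (t + 1) (t + 1) (t + 2)))))
      (B := c (x.length + M + a (x.length + M)) + 3)
      (I := fun k u => (∀ r < t, u.reg r = s.reg r) ∧ u.mem = s.mem ∧ u.reg (t + 1) = k ∧
        u.reg t = ∑ i ∈ Finset.range k, g x (scons i fun j => s.reg (ρ j)))
      ⟨hs₁r, hs₁m, by simp [hs₁], by simp [hs₁]⟩ (by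
        rintro k hk u ⟨u1, u2, u3, u4⟩
        obtain ⟨d1, d2, d3, d4⟩ := hQ x u (hs.congr (u1 0 ht) u2)
        have hv : (fun i => u.reg (scons (t + 1) ρ i)) = scons k fun j => s.reg (ρ j) := by
          funext i
          cases i with
          | zero => exact u3
          | succ i => exact u1 _ (hρ i)
        rw [hv] at d1
        rw [hs₁2] at hk
        have ha' := hav x _ M hM
        have cost := d4 (M + a (x.length + M)) (by
          intro i
          rw [congrFun hv i]
          cases i with
          | zero => simp only [scons]; omega
          | succ i => exact (hM i).trans (by omega))
        rw [← add_assoc] at cost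
        simp only [Prog.exec, setReg_reg, setReg_mem]
        refine ⟨⟨fun r hr => ?_, d3.trans u2, ?_, ?_⟩, by omega⟩
        · rw [Function.update_of_ne (by omega), Function.update_of_ne (by omega),
            Function.update_of_ne (by omega), d2 r (by omega), u1 r hr]
        · rw [Function.update_self, Function.update_of_ne (by omega), Function.update_self,
            Function.update_of_ne (by omega), d2 _ (by omega), u3]
        · rw [Function.update_of_ne (by omega), Function.update_of_ne (by omega),
            Function.update_self, d1, d2 _ (by omega), u4, Finset.sum_range_succ])
    have hex : ∀ R : Prog, (Prog.seq P (.seq (.const t 0) (.seq (.const (t + 1) 0) R))).exec s =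
        ((R.exec s₁).1, (P.exec s).2 + (1 + (1 + (R.exec s₁).2))) := by
      intro R; rw [hs₁]; rfl
    rw [hex]
    obtain ⟨m, hm⟩ : ∃ m, ∀ i, s.reg (ρ i) ≤ m :=
      ⟨∑ j ∈ Finset.range t, s.reg j, fun i =>
        Finset.single_le_sum (f := s.reg) (fun _ _ => Nat.zero_le _)
          (Finset.mem_range.2 (hρ i))⟩
    refine ⟨?_, fun r hr => ?_, ?_, fun M hM => ?_⟩
    · rw [(loop m hm).1.2.2.2, hs₁2]
    · exact (loop m hm).1.1 r hr
    · exact (loop m hm).1.2.1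
    · have h1 := (loop M hM).2
      have h2 := e4 M hM
      rw [hs₁2] at h1
      have h3 : (f x fun i => s.reg (ρ i)) * (c (x.length + M + a (x.length + M)) + 3 + 1) ≤
          a (x.length + M) * (c (x.length + M + a (x.length + M)) + 4) :=
        Nat.mul_le_mul_right _ (hav x _ M hM)
      dsimp only
      omega

/-! ### Lists of bits computed by bounded sums -/

/-- The bit lists whose length and entries are given by bounded sums; an entry is computed from its
index in variable `0`. -/
def BList (F : List Bool → List Bool) : Prop :=
  ∃ L B, BSum L ∧ BSum B ∧
    ∀ x v, F x = (List.range (L x v)).map fun i => B x (scons i v) != 0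

/-- Lists given by bounded sums are computable in polynomial time. The entries are first stored
behind the input, since their computation reads it, and then moved to the front. -/
theorem BList.polyTimeComputable {F : List Bool → List Bool} (hF : BList F) :
    PolyTimeComputable F := by
  obtain ⟨L, B, hL, hB, hFx⟩ := hF
  obtain ⟨P, b, hb, hP⟩ := hL.compile (fun _ => 1) 2 (by omega) (by omega)
  obtain ⟨Q, c, hc, hQ⟩ := hB.compile (scons 3 fun _ => 1) 5 (by omega) (by
    intro i; cases i <;> simp [scons])
  obtain ⟨a, ha, hav⟩ := hL.bounded
  obtain ⟨body₁, hbody₁⟩ : ∃ p : Prog, p = .seq Q (.seq (.add 4 0 3) (.seq (.store 4 5)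
    (.seq (.const 4 1) (.add 3 3 4)))) := ⟨_, rfl⟩
  obtain ⟨body₂, hbody₂⟩ : ∃ p : Prog, p = .seq (.add 4 0 3) (.seq (.load 5 4) (.seq (.store 3 5)
    (.seq (.const 4 1) (.add 3 3 4)))) := ⟨_, rfl⟩
  obtain ⟨-, K, k, hbound⟩ : PolyBounded fun m => b m + 6 + (a m * (c (m + a m) + 5) + a m * 6) :=
    (hb.add (.const 6)).add ((ha.mul ((hc.comp (PolyBounded.id.add ha)).add (.const 5))).add
      (ha.mul (.const 6)))
  refine ⟨.seq P (.seq (.const 3 0) (.seq (.loop 2 body₁) (.seq (.const 3 0)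
    (.seq (.loop 2 body₂) (.seq (.const 0 0) (.add 0 0 2)))))), K, k, fun x => ?_⟩
  obtain ⟨e1, e2, e3, e4⟩ := hP x (initial x) ⟨rfl, fun _ _ => rfl⟩
  obtain ⟨l, hl⟩ : ∃ l, l = L x fun _ => 0 := ⟨_, rfl⟩
  have hv0 : (fun _ : ℕ => (initial x).reg 1) = fun _ => 0 := rfl
  rw [hv0, ← hl] at e1
  have hla : l ≤ a x.length := hl ▸ hav x _ 0 fun _ => le_rfl
  have ecost : (P.exec (initial x)).2 ≤ b x.length := e4 0 fun _ => le_rfl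
  -- the first loop stores the entries behind the input
  obtain ⟨s₁, hs₁⟩ : ∃ s₁, s₁ = (P.exec (initial x)).1.setReg 3 0 := ⟨_, rfl⟩
  have r10 : s₁.reg 0 = x.length := by
    rw [hs₁, setReg_reg, Function.update_of_ne (by omega), e2 0 (by omega)]; rfl
  have r11 : s₁.reg 1 = 0 := by
    rw [hs₁, setReg_reg, Function.update_of_ne (by omega), e2 1 (by omega)]; rfl
  have r12 : s₁.reg 2 = l := by simp [hs₁, e1]
  have r1m : s₁.mem = fun i => (x.getD i false).toNat := by
    rw [hs₁, setReg_mem, e3]; rfl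
  have loop₁ := exec_loop (P := body₁) (r := 2) (s := s₁) (B := c (x.length + a x.length) + 4)
    (I := fun k u => u.reg 0 = x.length ∧ u.reg 1 = 0 ∧ u.reg 2 = l ∧ u.reg 3 = k ∧
      (∀ i < x.length, u.mem i = (x.getD i false).toNat) ∧
      ∀ i < k, u.mem (x.length + i) = B x (scons i fun _ => 0))
    ⟨r10, r11, r12, by simp [hs₁], fun i _ => by rw [r1m], fun i hi => by omega⟩ (by
      rintro k hk u ⟨u0, u1, u2, u3, u4, u5⟩
      obtain ⟨d1, d2, d3, d4⟩ := hQ x u ⟨u0, u4⟩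
      have hv : (fun i => u.reg (scons 3 (fun _ => 1) i)) = scons k fun _ => 0 := by
        funext i
        cases i with
        | zero => exact u3
        | succ i => exact u1
      rw [hv] at d1
      rw [r12] at hk
      have cost := d4 (a x.length) (by
        intro i
        rw [congrFun hv i]
        cases i with
        | zero => simp only [scons]; omega
        | succ i => exact Nat.zero_le _)
      simp only [hbody₁, Prog.exec, setReg_reg, setReg_mem, setMem_reg, setMem_mem]
      have q0 := (d2 0 (by omega)).trans u0
      have q3 := (d2 3 (by omega)).trans u3
      refine ⟨⟨?_, ?_, ?_, ?_, fun i hi => ?_, fun i hi => ?_⟩, by omega⟩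
      · simpa using q0
      · simpa [d2] using u1
      · simpa [d2] using u2
      · simpa using q3
      · simp only [Function.update_self, q0, q3, d3]
        rw [Function.update_of_ne (by omega), u4 i hi]
      · simp only [Function.update_self, q0, q3, d3]
        rcases (Nat.lt_succ_iff.1 hi).eq_or_lt with rfl | h
        · rw [Function.update_self, Function.update_of_ne (by omega), d1]
        · rw [Function.update_of_ne (by omega), u5 i h])
  rw [r12] at loop₁
  obtain ⟨⟨v0, -, v2, -, -, v5⟩, cost₁⟩ := loop₁
  -- the second loop moves them to the front
  obtain ⟨s₂, hs₂⟩ : ∃ s₂, s₂ = ((Prog.loop 2 body₁).exec s₁).1.setReg 3 0 := ⟨_, rfl⟩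
  have r20 : s₂.reg 0 = x.length := by simp [hs₂, v0]
  have r22 : s₂.reg 2 = l := by simp [hs₂, v2]
  have r2m : s₂.mem = ((Prog.loop 2 body₁).exec s₁).1.mem := by simp [hs₂]
  have loop₂ := exec_loop (P := body₂) (r := 2) (s := s₂) (B := 5)
    (I := fun k u => u.reg 0 = x.length ∧ u.reg 2 = l ∧ u.reg 3 = k ∧
      (∀ i < k, u.mem i = B x (scons i fun _ => 0)) ∧
      ∀ i < l, k ≤ i → u.mem (x.length + i) = B x (scons i fun _ => 0))
    ⟨r20, r22, by simp [hs₂], fun i hi => by omega, fun i hi _ => by rw [r2m, v5 i hi]⟩ (by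
      rintro k hk u ⟨u0, u2, u3, u4, u5⟩
      rw [r22] at hk
      simp only [hbody₂, Prog.exec, setReg_reg, setReg_mem, setMem_reg, setMem_mem]
      refine ⟨⟨?_, ?_, ?_, fun i hi => ?_, fun i hi hi' => ?_⟩, by omega⟩
      · simpa using u0
      · simpa using u2
      · simpa using u3
      · simp [u0, u3]
        rcases (Nat.lt_succ_iff.1 hi).eq_or_lt with rfl | h
        · rw [Function.update_self, u5 i hk le_rfl]
        · rw [Function.update_of_ne (by omega), u4 i h]
      · simp [u0, u3]
        rw [Function.update_of_ne (by omega), u5 i hi (by omega)])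
  rw [r22] at loop₂
  obtain ⟨⟨-, w2, -, w4, -⟩, cost₂⟩ := loop₂
  have hex : (Prog.seq P (.seq (.const 3 0) (.seq (.loop 2 body₁) (.seq (.const 3 0)
      (.seq (.loop 2 body₂) (.seq (.const 0 0) (.add 0 0 2))))))).exec (initial x) =
      ((((Prog.loop 2 body₂).exec s₂).1.setReg 0 0).setReg 0
        ((((Prog.loop 2 body₂).exec s₂).1.setReg 0 0).reg 0 +
          (((Prog.loop 2 body₂).exec s₂).1.setReg 0 0).reg 2),
        (P.exec (initial x)).2 + (1 + (((Prog.loop 2 body₁).exec s₁).2 + (1 +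
          (((Prog.loop 2 body₂).exec s₂).2 + (1 + 1)))))) := by
    rw [hs₂, hs₁]; rfl
  rw [hex]
  constructor
  · rw [hFx x fun _ => 0, ← hl, output]
    simp only [setReg_reg, setReg_mem, Function.update_self]
    rw [zero_add, Function.update_of_ne (by omega), w2]
    refine List.map_congr_left fun i hi => ?_
    rw [w4 i (List.mem_range.1 hi)]
  · refine le_trans ?_ (hbound x.length)
    have h1 : l * (c (x.length + a x.length) + 4 + 1) ≤
        a x.length * (c (x.length + a x.length) + 5) := Nat.mul_le_mul_right _ hla
    dsimp only
    omega

/-! ### Arithmetic by bounded sums -/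

/-- Substitution for the variables. -/
theorem BSum.subst {f} (hf : BSum f) : ∀ σ : ℕ → List Bool → (ℕ → ℕ) → ℕ, (∀ i, BSum (σ i)) →
    BSum fun x v => f x fun i => σ i x v := by
  induction hf with
  | var i => exact fun σ hσ => hσ i
  | const k => exact fun _ _ => .const k
  | len => exact fun _ _ => .len
  | read _ ih => exact fun σ hσ => (ih σ hσ).read
  | add _ _ ih₁ ih₂ => exact fun σ hσ => (ih₁ σ hσ).add (ih₂ σ hσ)
  | sub _ _ ih₁ ih₂ => exact fun σ hσ => (ih₁ σ hσ).sub (ih₂ σ hσ)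
  | @sum f g _ _ ih₁ ih₂ =>
    intro σ hσ
    -- below the binder, variable `0` is kept and the substituted terms are shifted
    obtain ⟨τ, h0, hs⟩ : ∃ τ : ℕ → List Bool → (ℕ → ℕ) → ℕ, (τ 0 = fun _ v => v 0) ∧
        ∀ i, τ (i + 1) = fun x v => σ i x fun j => v (j + 1) :=
      ⟨fun i => Nat.casesOn i (fun _ v => v 0) fun i x v => σ i x fun j => v (j + 1),
        rfl, fun _ => rfl⟩
    have := (ih₁ σ hσ).sum (ih₂ τ fun i => by
      cases i with
      | zero => rw [h0]; exact .var 0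
      | succ i => rw [hs]; exact (hσ i).weaken)
    have e : ∀ (x : List Bool) (v : ℕ → ℕ) (i : ℕ), (fun j => τ j x (scons i v)) =
        scons i fun j => σ j x v := fun x v i => by
      funext j
      cases j with
      | zero => rw [h0]; rfl
      | succ j => rw [hs]; rfl
    simpa only [e] using this

/-- Composition with functions given by bounded sums. -/
theorem BSum.comp₂ {g : List Bool → ℕ → ℕ → ℕ} (hg : BSum fun x v => g x (v 0) (v 1)) {a b}
    (ha : BSum a) (hb : BSum b) : BSum fun x v => g x (a x v) (b x v) :=
  hg.subst (fun i => if i = 0 then a else b) fun i => by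
    split_ifs <;> assumption

theorem BSum.comp₃ {g : List Bool → ℕ → ℕ → ℕ → ℕ} (hg : BSum fun x v => g x (v 0) (v 1) (v 2))
    {a b c} (ha : BSum a) (hb : BSum b) (hc : BSum c) :
    BSum fun x v => g x (a x v) (b x v) (c x v) :=
  hg.subst (fun i => if i = 0 then a else if i = 1 then b else c) fun i => by
    split_ifs <;> assumption

theorem BSum.mul {f g} (hf : BSum f) (hg : BSum g) : BSum fun x v => f x v * g x v := by
  have := hf.sum hg.weaken
  simpa [scons] using this

/-- The predicates decided by a bounded sum. -/
def BPred (p : List Bool → (ℕ → ℕ) → Prop) : Prop := ∃ f, BSum f ∧ ∀ x v, p x v ↔ f x v ≠ 0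

theorem BPred.lt {f g} (hf : BSum f) (hg : BSum g) : BPred fun x v => f x v < g x v :=
  ⟨_, hg.sub hf, fun x v => by omega⟩

theorem BPred.not {p} (hp : BPred p) : BPred fun x v => ¬ p x v := by
  obtain ⟨f, hf, h⟩ := hp
  exact ⟨_, (BSum.const 1).sub hf, fun x v => by simp only [h]; omega⟩

theorem BPred.and {p q} (hp : BPred p) (hq : BPred q) : BPred fun x v => p x v ∧ q x v := by
  obtain ⟨f, hf, h⟩ := hp
  obtain ⟨g, hg, h'⟩ := hq
  exact ⟨_, hf.mul hg, fun x v => by simp only [h, h', mul_ne_zero_iff]⟩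

theorem BPred.le {f g} (hf : BSum f) (hg : BSum g) : BPred fun x v => f x v ≤ g x v := by
  simpa only [not_lt] using (BPred.lt hg hf).not

theorem BPred.eq {f g} (hf : BSum f) (hg : BSum g) : BPred fun x v => f x v = g x v := by
  simpa only [le_antisymm_iff] using (BPred.le hf hg).and (BPred.le hg hf)

/-- Bounded quantification; the bound variable is variable `0`. -/
theorem BPred.bex {f p} (hf : BSum f) (hp : BPred p) :
    BPred fun x v => ∃ i < f x v, p x (scons i v) := by
  obtain ⟨g, hg, h⟩ := hp
  refine ⟨_, hf.sum hg, fun x v => ?_⟩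
  simp [Finset.sum_eq_zero_iff, h]

theorem BSum.ite {p f g} (hp : BPred p) [∀ x v, Decidable (p x v)] (hf : BSum f) (hg : BSum g) :
    BSum fun x v => if p x v then f x v else g x v := by
  obtain ⟨e, he, h⟩ := hp
  have := (((BSum.const 1).sub ((BSum.const 1).sub he)).mul hf).add
    (((BSum.const 1).sub he).mul hg)
  convert this using 3 with x v
  by_cases h0 : e x v = 0
  · simp [h, h0]
  · rw [if_pos ((h x v).2 h0), Nat.sub_eq_zero_of_le (Nat.pos_of_ne_zero h0)]
    simp

/-- The quotient counts the `i < f` with `(i + 1) g ≤ f`; the test `0 < g` accounts for the value `0`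
of division by zero. -/
theorem BSum.div {f g} (hf : BSum f) (hg : BSum g) : BSum fun x v => f x v / g x v := by
  refine BSum.comp₂ (g := fun _ a b => a / b) ?_ hf hg
  have := (BSum.var 0).sum (.ite ((BPred.lt (.const 0) (.var 2)).and
    (.le (((BSum.var 0).add (.const 1)).mul (.var 2)) (.var 1))) (.const 1) (.const 0))
  convert this using 3 with x v
  simp only [scons]
  rcases Nat.eq_zero_or_pos (v 1) with h | h
  · simp [h]
  · simp only [h, true_and, ← Nat.le_div_iff_mul_le h, Nat.add_one_le_iff]
    rw [← Finset.sum_filter, Finset.sum_const, smul_eq_mul, mul_one]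
    have : (Finset.range (v 0)).filter (fun i => i < v 0 / v 1) = Finset.range (v 0 / v 1) := by
      ext i
      have := Nat.div_le_self (v 0) (v 1)
      simp only [Finset.mem_filter, Finset.mem_range]
      omega
    rw [this, Finset.card_range]

theorem BSum.mod {f g} (hf : BSum f) (hg : BSum g) : BSum fun x v => f x v % g x v := by
  simpa only [Nat.mod_eq_sub_mul_div] using hf.sub (hg.mul (hf.div hg))

theorem BSum.pow {f} (hf : BSum f) (k : ℕ) : BSum fun x v => f x v ^ k := by
  induction k with
  | zero => simpa using BSum.const 1
  | succ k ih => simpa only [pow_succ] using ih.mul hf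

theorem BSum.choose_two {f} (hf : BSum f) : BSum fun x v => (f x v).choose 2 := by
  simpa only [Nat.choose_two_right] using (hf.mul (hf.sub (.const 1))).div (.const 2)

theorem BSum.choose_three {f} (hf : BSum f) : BSum fun x v => (f x v).choose 3 := by
  have h : ∀ n : ℕ, n.choose 3 = ∑ i ∈ Finset.range n, i.choose 2 := by
    intro n
    induction n with
    | zero => rfl
    | succ n ih => rw [Finset.sum_range_succ, ← ih, Nat.choose_succ_succ', add_comm]
  have := hf.sum (BSum.var 0).choose_two
  simpa only [h, scons] using this

/-- A power of two is a positive number without odd divisors other than `1`. -/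
theorem exists_eq_two_pow_iff (p : ℕ) :
    (∃ k, p = 2 ^ k) ↔ 0 < p ∧ ¬ ∃ d < p + 1, p % d = 0 ∧ d % 2 = 1 ∧ 1 < d := by
  constructor
  · rintro ⟨k, rfl⟩
    refine ⟨by positivity, ?_⟩
    rintro ⟨d, -, h1, h2, h3⟩
    obtain ⟨j, -, rfl⟩ := (Nat.dvd_prime_pow Nat.prime_two).1 (Nat.dvd_of_mod_eq_zero h1)
    cases j with
    | zero => simp at h3
    | succ j => rw [pow_succ] at h2; omega
  · rintro ⟨h0, h⟩
    rcases Nat.eq_two_pow_or_exists_odd_prime_and_dvd p with ⟨k, hk⟩ | ⟨q, hq, hqp, hodd⟩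
    · exact ⟨k, hk⟩
    · exact absurd ⟨q, Nat.lt_succ_of_le (Nat.le_of_dvd h0 hqp), Nat.mod_eq_zero_of_dvd hqp,
        Nat.odd_iff.1 hodd, hq.one_lt⟩ h

theorem BPred.two_pow {f} (hf : BSum f) : BPred fun x v => ∃ k, f x v = 2 ^ k := by
  simp only [exists_eq_two_pow_iff]
  exact (BPred.lt (.const 0) hf).and (BPred.bex (hf.add (.const 1))
    ((BPred.eq (hf.weaken.mod (.var 0)) (.const 0)).and
      ((BPred.eq ((BSum.var 0).mod (.const 2)) (.const 1)).and (.lt (.const 1) (.var 0))))).not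

/-- The number of powers of two below `m`. -/
theorem clog_two_eq_sum [DecidablePred fun p : ℕ => ∃ k, p = 2 ^ k] (m : ℕ) :
    Nat.clog 2 m = ∑ p ∈ Finset.range m, if ∃ k, p = 2 ^ k then 1 else 0 := by
  rw [← Finset.sum_filter, Finset.sum_const, smul_eq_mul, mul_one]
  have : (Finset.range m).filter (fun p => ∃ k, p = 2 ^ k) =
      (Finset.range (Nat.clog 2 m)).image (2 ^ ·) := by
    ext p
    simp only [Finset.mem_filter, Finset.mem_range, Finset.mem_image]
    constructor
    · rintro ⟨h, k, rfl⟩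
      exact ⟨k, (Nat.lt_clog_iff_pow_lt one_lt_two).2 h, rfl⟩
    · rintro ⟨k, h, rfl⟩
      exact ⟨(Nat.lt_clog_iff_pow_lt one_lt_two).1 h, k, rfl⟩
  rw [this, Finset.card_image_of_injective _ (Nat.pow_right_injective le_rfl), Finset.card_range]

theorem BSum.clog_two {f} (hf : BSum f) : BSum fun x v => Nat.clog 2 (f x v) := by
  classical
  have := hf.sum (.ite (BPred.two_pow (.var 0)) (.const 1) (.const 0))
  simp only [clog_two_eq_sum]
  exact this

/-- The binary digits without exponentials: `p` runs over the powers of two up to `m`. -/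
theorem testBit_iff_exists (m i : ℕ) :
    m.testBit i = true ↔ ∃ p < m + 1, (∃ k, p = 2 ^ k) ∧ Nat.clog 2 p = i ∧ m / p % 2 = 1 := by
  rw [Nat.testBit_eq_decide_div_mod_eq, decide_eq_true_iff]
  constructor
  · intro h
    refine ⟨2 ^ i, ?_, ⟨i, rfl⟩, Nat.clog_pow 2 i one_lt_two, h⟩
    by_contra hlt
    rw [Nat.div_eq_of_lt (by omega)] at h
    simp at h
  · rintro ⟨p, -, ⟨k, rfl⟩, h, h'⟩
    rw [Nat.clog_pow 2 k one_lt_two] at h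
    rwa [← h]

theorem BSum.testBit {f g} (hf : BSum f) (hg : BSum g) :
    BSum fun x v => ((f x v).testBit (g x v)).toNat := by
  have : BPred fun x v => (f x v).testBit (g x v) = true := by
    simp only [testBit_iff_exists]
    exact BPred.bex (hf.add (.const 1)) ((BPred.two_pow (.var 0)).and
      ((BPred.eq (BSum.var 0).clog_two hg.weaken).and
        (.eq ((hf.weaken.div (.var 0)).mod (.const 2)) (.const 1))))
  convert BSum.ite this (.const 1) (.const 0) using 3 with x v
  cases (f x v).testBit (g x v) <;> rfl

/-! ### The sketch by bounded sums -/

/-- The bits of a block, read from the whole string. -/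
theorem bit_take_drop (x : List Bool) (s L i : ℕ) :
    (bit ((x.drop s).take L) i).toNat =
      if i = 0 then 0 else if i - 1 < min L (x.length - s) then (x.getD (s + (i - 1)) false).toNat
        else 1 := by
  cases i with
  | zero => simp [bit, ext]
  | succ i =>
    simp only [bit, ext, List.getD_cons_succ, Nat.add_sub_cancel, Nat.succ_ne_zero, if_false]
    have hlen : ((x.drop s).take L).length = min L (x.length - s) := by simp
    split_ifs with h
    · rw [List.getD_append _ _ _ _ (by omega)]
      simp only [List.getD_eq_getElem?_getD, List.getElem?_take, List.getElem?_drop]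
      rw [if_pos (by omega), List.getElem?_eq_getElem (by omega)]
      simp
    · rw [List.getD_append_right _ _ _ _ (by omega)]
      rcases Nat.eq_zero_or_pos (i - ((x.drop s).take L).length) with h | h
      · rw [h]; rfl
      · rw [List.getD_eq_default _ _ (by rw [List.length_singleton]; exact h)]; rfl

theorem BSum.min {f g} (hf : BSum f) (hg : BSum g) : BSum fun x v => min (f x v) (g x v) := by
  simpa only [min_def] using BSum.ite (.le hf hg) hf hg

/-- The bits of the block of length at most `L` that starts after position `s`, where `s`, `L` and
the position in the block are given by the variables `0`, `1`, `2`. -/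
theorem BSum.bit_block : BSum fun x v => (bit ((x.drop (v 0)).take (v 1)) (v 2)).toNat := by
  simp only [bit_take_drop]
  exact .ite (.eq (.var 2) (.const 0)) (.const 0) (.ite
    (.lt ((BSum.var 2).sub (.const 1)) ((BSum.var 1).min (BSum.len.sub (.var 0))))
    ((BSum.var 0).add ((BSum.var 2).sub (.const 1))).read (.const 1))

theorem BSum.length_block : BSum fun x v => ((x.drop (v 0)).take (v 1)).length := by
  simpa only [List.length_take, List.length_drop] using (BSum.var 1).min (BSum.len.sub (.var 0))

theorem rank_eq_sum (x : List Bool) (i : ℕ) :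
    rank x i = ∑ j ∈ Finset.range i, if (bit x (j + 1)).toNat = (bit x j).toNat then 0 else 1 := by
  induction i with
  | zero => rfl
  | succ i ih =>
    rw [Finset.sum_range_succ, ← ih, rank]
    cases bit x (i + 1) <;> cases bit x i <;> simp

theorem BSum.rank_block : BSum fun x v => rank ((x.drop (v 0)).take (v 1)) (v 2) := by
  simp only [rank_eq_sum]
  have h {f} (hf : BSum f) := BSum.comp₃
    (g := fun x s L i => (bit ((x.drop s).take L) i).toNat) BSum.bit_block (.var 1) (.var 2) hf
  exact (BSum.var 2).sum (.ite (.eq (h ((BSum.var 0).add (.const 1))) (h (.var 0)))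
    (.const 0) (.const 1))

theorem sum_Icc_one (n : ℕ) (f : ℕ → ℕ) :
    ∑ i ∈ Finset.Icc 1 n, f i = ∑ i ∈ Finset.range n, f (i + 1) := by
  rw [Finset.range_eq_Ico, Finset.sum_Ico_add' f 0 n 1]
  rfl

/-- Sums over the ranks of a block, which is given by the variables `0` and `1`. -/
theorem BSum.sum_rank (φ : ℕ → ℕ) (hφ : ∀ {f}, BSum f → BSum fun x v => φ (f x v)) :
    BSum fun x v => ∑ i ∈ Finset.Icc 1 (((x.drop (v 0)).take (v 1)).length + 1),
      φ (rank ((x.drop (v 0)).take (v 1)) i) := by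
  simp only [sum_Icc_one]
  exact (BSum.length_block.add (.const 1)).sum (hφ (BSum.comp₃
    (g := fun x s L i => rank ((x.drop s).take L) i) BSum.rank_block (.var 1) (.var 2)
    ((BSum.var 0).add (.const 1))))

theorem BSum.f2r_block : BSum fun x v => f2r ((x.drop (v 0)).take (v 1)) :=
  BSum.sum_rank (·.choose 2) fun h => h.choose_two

theorem BSum.f3r_block : BSum fun x v => f3r ((x.drop (v 0)).take (v 1)) :=
  BSum.sum_rank (·.choose 3) fun h => h.choose_three

/-- A function of blocks, applied to the whole string. -/
theorem BSum.of_block {g : List Bool → ℕ} (hg : BSum fun x v => g ((x.drop (v 0)).take (v 1))) :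
    BSum fun x _ => g x := by
  simpa using BSum.comp₂ (g := fun x s L => g ((x.drop s).take L)) hg (.const 0) .len

theorem BSum.f1r : BSum fun x _ => f1r x :=
  .of_block (BSum.sum_rank id fun h => h)

theorem BSum.bit {f} (hf : BSum f) : BSum fun x v => (TwoDeletion.bit x (f x v)).toNat := by
  simpa using BSum.comp₃ (g := fun x s L i => (TwoDeletion.bit ((x.drop s).take L) i).toNat)
    BSum.bit_block (.const 0) .len hf

theorem BSum.f1 : BSum fun x _ => f1 x := by
  simp only [TwoDeletion.f1, sum_Icc_one]
  have h := (BSum.var 0).add (.const 1)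
  exact BSum.len.sum (h.mul h.bit)

theorem BSum.f2 : BSum fun x _ => f2 x := by
  simp only [TwoDeletion.f2, sum_Icc_one]
  have h := (BSum.var 0).add (.const 1)
  exact BSum.len.sum (h.choose_two.mul h.bit)

theorem numOnes_eq_sum (x : List Bool) :
    numOnes x = ∑ i ∈ Finset.range x.length, (x.getD i false).toNat := by
  induction x with
  | nil => rfl
  | cons b x ih =>
    rw [List.length_cons, Finset.sum_range_succ']
    simp only [List.getD_cons_succ, List.getD_cons_zero, ← ih, numOnes]
    cases b <;> simp

theorem BSum.numOnes : BSum fun x _ => numOnes x := by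
  simp only [numOnes_eq_sum]
  exact BSum.len.sum (BSum.var 0).read

theorem BSum.numRuns : BSum fun x _ => numRuns x :=
  .of_block ((BSum.comp₃ (g := fun x s L i => rank ((x.drop s).take L) i) BSum.rank_block (.var 0)
    (.var 1) (BSum.length_block.add (.const 1))).add (.const 1))

theorem BSum.clog_length : BSum fun x _ => Nat.clog 2 x.length := BSum.len.clog_two

theorem BSum.halfBlock (d : ℕ) : BSum fun x _ => halfBlock d x.length := (BSum.len.pow d).clog_two

/-- The bits of an exclusive-or are the parities of the numbers of set bits. -/
theorem testBit_xorSketch (f : List Bool → ℕ) (bs : List (List Bool)) (i : ℕ) :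
    ((xorSketch f bs).testBit i).toNat = (bs.map fun b => ((f b).testBit i).toNat).sum % 2 := by
  induction bs with
  | nil => simp [xorSketch]
  | cons b bs ih =>
    rw [List.map_cons, List.sum_cons, Nat.add_mod, ← ih]
    simp only [xorSketch, List.foldr_cons, Nat.testBit_xor]
    cases (f b).testBit i <;>
      cases (List.foldr (fun b acc => f b ^^^ acc) 0 bs).testBit i <;> rfl

theorem sum_map_blocks (g : List Bool → ℕ) (B : ℕ) (x : List Bool) :
    ((blocks B x).map g).sum =
      ∑ k ∈ Finset.range ((x.length + B - 1) / B), g ((x.drop (k * B)).take B) := by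
  rw [blocks, List.map_map]
  rfl

theorem BSum.testBit_xorSketch_blocks {g : List Bool → ℕ}
    (hg : BSum fun x v => g ((x.drop (v 0)).take (v 1))) (d : ℕ) :
    BSum fun x v =>
      ((xorSketch g (blocks (2 * TwoDeletion.halfBlock d x.length) x)).testBit (v 0)).toNat := by
  simp only [testBit_xorSketch, sum_map_blocks]
  have hB := (BSum.const 2).mul (BSum.halfBlock d)
  exact ((((BSum.len.add hB).sub (.const 1)).div hB).sum ((BSum.comp₂
    (g := fun x s L => g ((x.drop s).take L)) hg ((BSum.var 0).mul hB) hB).testBit (.var 1))).mod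
      (.const 2)

theorem BSum.testBit_xorSketch_shiftedBlocks {g : List Bool → ℕ}
    (hg : BSum fun x v => g ((x.drop (v 0)).take (v 1))) (d : ℕ) :
    BSum fun x v => ((xorSketch g
      (shiftedBlocks (TwoDeletion.halfBlock d x.length) x)).testBit (v 0)).toNat := by
  have hh := BSum.halfBlock d
  have hB := (BSum.const 2).mul hh
  have h₀ := (BSum.comp₂ (g := fun x s L => g ((x.drop s).take L)) hg (.const 0) hh).testBit
    (.var 0)
  have h₁ := ((((BSum.len.sub hh).add hB).sub (.const 1)).div hB).sum ((BSum.comp₂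
    (g := fun x s L => g ((x.drop s).take L)) hg (hh.add ((BSum.var 0).mul hB)) hB).testBit
      (.var 1))
  simp only [testBit_xorSketch, shiftedBlocks, List.map_cons, List.sum_cons, sum_map_blocks,
    List.drop_drop, List.length_drop]
  exact (h₀.add h₁).mod (.const 2)

theorem BList.lowBits {w m : List Bool → ℕ} (hw : BSum fun x _ => w x)
    (hm : BSum fun x v => ((m x).testBit (v 0)).toNat) :
    BList fun x => lowBits (w x) (m x) := by
  refine ⟨_, _, hw, hm, fun x v => List.map_congr_left fun i _ => ?_⟩
  simp only [scons]
  cases (m x).testBit i <;> rfl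

theorem BList.append {F G : List Bool → List Bool} (hF : BList F) (hG : BList G) :
    BList fun x => F x ++ G x := by
  obtain ⟨L₁, B₁, hL₁, hB₁, h₁⟩ := hF
  obtain ⟨L₂, B₂, hL₂, hB₂, h₂⟩ := hG
  -- the entries of the second list with the index shifted back by the length of the first
  have hshift : BSum fun x v => B₂ x (scons (v 0 - L₁ x fun i => v (i + 1)) fun i => v (i + 1)) := by
    have := hB₂.subst (fun i => Nat.casesOn i (fun x v => v 0 - L₁ x fun i => v (i + 1))
      fun i _ v => v (i + 1)) fun i => by
        cases i with
        | zero => exact (BSum.var 0).sub hL₁.weaken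
        | succ i => exact .var (i + 1)
    convert this using 4 with x v
    funext i
    cases i <;> rfl
  refine ⟨_, _, hL₁.add hL₂, .ite (.lt (.var 0) hL₁.weaken) hB₁ hshift, fun x v => ?_⟩
  simp only [h₁ x v, h₂ x v]
  rw [List.range_add, List.map_append, List.map_map]
  congr 1
  · refine List.map_congr_left fun i hi => ?_
    change _ = ((if i < L₁ x v then B₁ x (scons i v) else B₂ x (scons (i - L₁ x v) v)) != 0)
    rw [if_pos (List.mem_range.1 hi)]
  · refine List.map_congr_left fun i _ => ?_
    simp [scons]

theorem BList.sketch (d c : ℕ) : BList (sketch d c) := by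
  have ha := BSum.clog_length
  have hb := ha.clog_two
  have hc := BSum.const c
  have h2b := ((BSum.const 2).mul hb).add hc
  have h3b := ((BSum.const 3).mul hb).add hc
  exact ((((((((BList.lowBits (ha.add hc) (BSum.f1.testBit (.var 0))).append
    (.lowBits (((BSum.const 2).mul ha).add hc) (BSum.f2.testBit (.var 0)))).append
    (.lowBits (ha.add hc) (BSum.f1r.testBit (.var 0)))).append
    (.lowBits h2b (.testBit_xorSketch_blocks .f2r_block d))).append
    (.lowBits h3b (.testBit_xorSketch_blocks .f3r_block d))).append
    (.lowBits h2b (.testBit_xorSketch_shiftedBlocks .f2r_block d))).append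
    (.lowBits h3b (.testBit_xorSketch_shiftedBlocks .f3r_block d))).append
    (.lowBits hc (BSum.numOnes.testBit (.var 0)))).append
    (.lowBits hc (BSum.numRuns.testBit (.var 0)))

end TwoDeletion

theorem theorem5p9 (d : ℝ) (hd : 0 < d) :
    ∃ c C : ℕ,
      TwoDeletion.PolyTimeComputable (TwoDeletion.sketch ⌈d⌉₊ c) ∧
      ∀ n : ℕ, 2 ≤ n →
        (∃ L : ℕ,
          (L : ℝ) ≤ 4 * Real.logb 2 (n : ℝ) + 10 * Real.logb 2 (Real.logb 2 (n : ℝ)) + (C : ℝ) ∧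
          ∀ x : List Bool, x.length = n → (TwoDeletion.sketch ⌈d⌉₊ c x).length = L) ∧
        ∀ x : List Bool, x.length = n → TwoDeletion.IsRegular d x →
          ∀ y : List Bool, y.Sublist x → y.length + 2 = n →
            ∀ z : List Bool, z.length = n → y.Sublist z →
              TwoDeletion.sketch ⌈d⌉₊ c z = TwoDeletion.sketch ⌈d⌉₊ c x → z = x := by
  -- any `c` with `512 ⌈d⌉₊ ^ 3 < 2 ^ c` does
  refine ⟨512 * ⌈d⌉₊ ^ 3, 24 + 9 * (512 * ⌈d⌉₊ ^ 3),
    (TwoDeletion.BList.sketch _ _).polyTimeComputable, fun n hn =>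
      ⟨⟨4 * Nat.clog 2 n + 10 * Nat.clog 2 (Nat.clog 2 n) + 9 * (512 * ⌈d⌉₊ ^ 3), ?_,
        fun x hx => ?_⟩, fun x hx hreg y hyx hy z hz hyz hs => ?_⟩⟩
  · have := TwoDeletion.length_sketch_le hn
    push_cast at this ⊢
    linarith
  · rw [TwoDeletion.length_sketch, hx]
  · exact (TwoDeletion.eq_of_sketch_eq hd Nat.lt_two_pow_self hreg hyx hyz (hx.trans hz.symm)
      (hy.trans hx.symm) hs.symm).symm
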